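/- Let $n\ge 1$. Cubes are (nondegenerate) cubes $Q\subset\mathbb R^n$ with sides parallel to the axes, $\langle f\rangle_Q=\frac1{|Q|}\int_Q f$, and $\mathcal D(Q)$ is the set of all cubes obtained by repeatedly subdividing $Q$ and its descendants into $2^n$ congruent subcubes ($Q$ included). A family $\mathcal F\subset\mathcal D(Q)$ is $\eta$-sparse if $\big|P\setminus\bigcup_{P'\in\mathcal F,\,P'\subsetneq P}P'\big|\ge\eta|P|$ for all $P\in\mathcal F$. A quasi-Banach function space over $Q$ is an order ideal $Y$ in the space of measurable functions $Q\to\mathbb R$ (modulo a.e. equality) with a quasi-norm such that: $|f|\le|g|$ implies $\|f\|_Y\le\|g\|_Y$ for $f,g\in Y$; some $f\in Y$ satisfies $f>0$ a.e.; and if $0\le f_k\uparrow f$ a.e. and $\sup_k\|f_k\|_Y<\infty$, then $f\in Y$ and $\|f\|_Y=\sup_k\|f_k\|_Y$. An inequality $\|f\|_Y\le C$ includes the claim $f\in Y$. A family $X=\{X_Q\}$, where for every cube $Q$ the space $X_Q$ is a quasi-Banach function space over $Q$, is called normalized if there are constants $0<a\le b<\infty$ with $a\le\|\chi_Q\|_{X_Q}\le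 b$ for all $Q$. For $f\in L^1_{\mathrm{loc}}(\mathbb R^n)$ let $\|f\|_{\mathrm{BMO}}=\sup_Q\frac1{|Q|}\int_Q|f-\langle f\rangle_Q|$ and $\|f\|_{\mathrm{BMO}_X}=\sup_Q\|f-\langle f\rangle_Q\|_{X_Q}$; $\mathrm{BMO}$ is the space of those $f$ with $\|f\|_{\mathrm{BMO}}<\infty$. For measurable $f$ on $Q$ let $\|f\|_{\exp L(Q)}=\inf\{\alpha>0:\frac1{|Q|}\int_Q(e^{|f|/\alpha}-1)\,dx\le1\}$; $\exp L(Q)$ is the space of those $f$ for which this is finite. **Theorem.** Let $X=\{X_Q\}$ be a normalized family of quasi-Banach function spaces and let $\eta,\gamma\in(0,1)$. The following statements are equivalent: (i) There is a constant $C_1>0$ such that $\|f\|_{\mathrm{BMO}_X}\le C_1\|f\|_{\mathrm{BMO}}$ for all $f\in\mathrm{BMO}$. (ii) There is a constant $C_2>0$ such that $\big\|\sum_{P\in\mathcal F}\chi_P\big\|_{X_Q}\le C_2$ for every cube $Q$ and every $\eta$-sparse family $\mathcal F\subset\mathcal D(Q)$. (iii) There is a constant $C_3>0$ such that $\big\|\sum_{k=0}^\infty\chi_{\Omega_k}\big\|_{X_Q}\le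 C_3$ for every cube $Q$ and all measurable sets $Q\supset\Omega_0\supset\Omega_1\supset\cdots$ with $|\Omega_k|\le\gamma^k|Q|$ for all $k\ge0$. (iv) There is a constant $C_4>0$ such that $\|f\|_{X_Q}\le C_4\|f\|_{\exp L(Q)}$ for every cube $Q$ and every $f\in\exp L(Q)$. Moreover the constants are comparable: there is $c=c(n,\eta,\gamma)\ge1$, independent of $X$, such that whenever one of the four estimates holds with a constant $C>0$, each of the other three holds with the constant $cC$. -/

import Mathlib

open MeasureTheory Filter Topology Set
open scoped ENNReal NNReal

noncomputable section

/-- A cube in `ℝⁿ` with sides parallel to the axes, given by its lower left corner and its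
side length. -/
@[ext]
structure Cube (n : ℕ) where
  corner : Fin n → ℝ
  side : ℝ
  side_pos : 0 < side

namespace Cube

variable {n : ℕ}

/-- The point set of a cube (the half-open representative). -/
def toSet (Q : Cube n) : Set (Fin n → ℝ) :=
  Set.univ.pi fun i => Set.Ico (Q.corner i) (Q.corner i + Q.side)

/-- One of the `2 ^ n` congruent subcubes of `Q`, selected by `ε : Fin n → Bool`. -/
def child (Q : Cube n) (ε : Fin n → Bool) : Cube n where
  corner := fun i => Q.corner i + (if ε i then Q.side / 2 else 0)
  side := Q.side / 2
  side_pos := half_pos Q.side_pos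

/-- `Q.IsDyadic P` says that `P` is a dyadic cube with respect to `Q`. -/
inductive IsDyadic (Q : Cube n) : Cube n → Prop
  | self : IsDyadic Q Q
  | child (P : Cube n) (ε : Fin n → Bool) : IsDyadic Q P → IsDyadic Q (P.child ε)

/-- The set `𝓓(Q)` of all dyadic cubes with respect to `Q`. -/
def dyadic (Q : Cube n) : Set (Cube n) := {P | Q.IsDyadic P}

end Cube

/-- The set `E_P`: what remains of `P` after removing the members of `F` strictly inside `P`. -/
def sparsePart {n : ℕ} (F : Set (Cube n)) (P : Cube n) : Set (Fin n → ℝ) :=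
  P.toSet \ ⋃ P' ∈ {P' ∈ F | P'.toSet ⊂ P.toSet}, P'.toSet

/-- The family `F` of (dyadic) cubes is `η`-sparse. -/
def IsSparse {n : ℕ} (η : ℝ) (F : Set (Cube n)) : Prop :=
  ∀ P ∈ F, η * volume.real P.toSet ≤ volume.real (sparsePart F P)

/-- A quasi-Banach function space over a measure space, given by its quasi-norm extended by `∞`
to functions outside the space: a function `f` belongs to the space iff `nrm f < ∞`. Functions
which are equal a.e. are identified (by `nrm_mono`, they have the same quasi-norm). -/
structure QuasiBanachFunctionSpace {α : Type*} [MeasurableSpace α] (μ : Measure α) where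
  nrm : (α → ℝ) → ℝ≥0∞
  /-- The space consists of measurable functions. -/
  aemeasurable_of_lt_top : ∀ f, nrm f < ∞ → AEMeasurable f μ
  nrm_eq_zero_iff : ∀ f, nrm f = 0 ↔ f =ᵐ[μ] 0
  nrm_smul : ∀ (c : ℝ) (f : α → ℝ), nrm (c • f) = ‖c‖ₑ * nrm f
  nrm_add_le : ∃ K : ℝ≥0, 1 ≤ K ∧ ∀ f g, nrm (f + g) ≤ K * (nrm f + nrm g)
  /-- Order ideal and compatibility. -/
  nrm_mono : ∀ f g, AEMeasurable f μ → (∀ᵐ x ∂μ, |f x| ≤ |g x|) → nrm f ≤ nrm g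
  /-- Weak order unit. -/
  exists_weak_unit : ∃ f, nrm f < ∞ ∧ ∀ᵐ x ∂μ, 0 < f x
  /-- Fatou property. -/
  fatou : ∀ (u : ℕ → α → ℝ) (f : α → ℝ),
    (∀ᵐ x ∂μ, ∀ k, 0 ≤ u k x) → (∀ᵐ x ∂μ, Monotone fun k => u k x) →
    (∀ᵐ x ∂μ, Tendsto (fun k => u k x) atTop (𝓝 (f x))) →
    (⨆ k, nrm (u k)) < ∞ → nrm f = ⨆ k, nrm (u k)

/-- A family assigning to every cube `Q` a quasi-Banach function space `X_Q` over `Q`. -/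
abbrev FunctionSpaceFamily (n : ℕ) : Type :=
  (Q : Cube n) → QuasiBanachFunctionSpace (volume.restrict Q.toSet)

/-- The family is normalized: `‖χ_Q‖_{X_Q} ≃ 1` uniformly in `Q`. -/
def IsNormalizedFamily {n : ℕ} (X : FunctionSpaceFamily n) : Prop :=
  ∃ a b : ℝ≥0, 0 < a ∧ ∀ Q : Cube n,
    a ≤ (X Q).nrm (Q.toSet.indicator 1) ∧ (X Q).nrm (Q.toSet.indicator 1) ≤ b

/-- `‖f‖_BMO`, for locally integrable `f`. -/
def bmoNorm {n : ℕ} (f : (Fin n → ℝ) → ℝ) : ℝ≥0∞ :=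
  ⨆ Q : Cube n, (volume Q.toSet)⁻¹ * ∫⁻ x in Q.toSet, ‖f x - ⨍ y in Q.toSet, f y‖ₑ

/-- `‖f‖_{BMO_X}`, for locally integrable `f`. -/
def bmoXNorm {n : ℕ} (X : FunctionSpaceFamily n) (f : (Fin n → ℝ) → ℝ) : ℝ≥0∞ :=
  ⨆ Q : Cube n, (X Q).nrm fun x => f x - ⨍ y in Q.toSet, f y

/-- The normalized Luxemburg norm
`‖f‖_{φ,Q} = inf {α > 0 : |Q|⁻¹ ∫_Q φ(|f| / α) ≤ 1}` (with `inf ∅ = ∞`). -/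
def luxemburgNorm {n : ℕ} (φ : ℝ → ℝ) (Q : Cube n) (f : (Fin n → ℝ) → ℝ) : ℝ≥0∞ :=
  ⨅ (α : ℝ) (_ : 0 < α ∧
      (volume Q.toSet)⁻¹ * ∫⁻ x in Q.toSet, ENNReal.ofReal (φ (|f x| / α)) ≤ 1),
    ENNReal.ofReal α

/-- The norm of `exp L(Q)`. -/
def expLNorm {n : ℕ} (Q : Cube n) (f : (Fin n → ℝ) → ℝ) : ℝ≥0∞ :=
  luxemburgNorm (fun t => Real.exp t - 1) Q f

/-- `BMO ↪ BMO_X` with constant `C`. -/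
def BMOEmbedding {n : ℕ} (X : FunctionSpaceFamily n) (C : ℝ≥0) : Prop :=
  ∀ f : (Fin n → ℝ) → ℝ, LocallyIntegrable f → bmoNorm f < ∞ →
    bmoXNorm X f ≤ C * bmoNorm f

/-- The bound over `η`-sparse families with constant `C`. (The sum is finite outside a null
set, so its value there plays no role.) -/
def SparseBound {n : ℕ} (η : ℝ) (X : FunctionSpaceFamily n) (C : ℝ≥0) : Prop :=
  ∀ (Q : Cube n) (F : Set (Cube n)), F ⊆ Q.dyadic → IsSparse η F →
    (X Q).nrm (fun x => ∑' P : F, P.1.toSet.indicator (fun _ => (1 : ℝ)) x) ≤ C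

/-- The bound over nested sequences of sets with constant `C`. (The sum is finite outside the
null set `⋂ k, Ω k`, so its value there plays no role.) -/
def NestedBound {n : ℕ} (γ : ℝ) (X : FunctionSpaceFamily n) (C : ℝ≥0) : Prop :=
  ∀ (Q : Cube n) (Ω : ℕ → Set (Fin n → ℝ)), (∀ k, MeasurableSet (Ω k)) →
    (∀ k, Ω k ⊆ Q.toSet) → (∀ k, Ω (k + 1) ⊆ Ω k) →
    (∀ k, volume.real (Ω k) ≤ γ ^ k * volume.real Q.toSet) →
    (X Q).nrm (fun x => ∑' k, (Ω k).indicator (fun _ => (1 : ℝ)) x) ≤ C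

/-- `exp L(Q) ↪ X_Q` for all cubes `Q`, with constant `C`. -/
def ExpLEmbedding {n : ℕ} (X : FunctionSpaceFamily n) (C : ℝ≥0) : Prop :=
  ∀ (Q : Cube n) (f : (Fin n → ℝ) → ℝ), AEMeasurable f (volume.restrict Q.toSet) →
    expLNorm Q f < ∞ → (X Q).nrm f ≤ C * expLNorm Q f

end

/-!
The exponential space is the hub: each estimate implies the embedding of `exp L`, which in turn
implies each of them. The constants of the quasi-triangle inequalities of the spaces `X_Q` are not
assumed to be uniform in `Q`, so only homogeneity and the lattice property of the quasi-norms are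
used, and every implication rests on a pointwise domination of functions on `Q`.

* Nested sets and `exp L` (`NestedBound.of_expLEmbedding`, `ExpLEmbedding.of_nestedBound`): if
  `|Ωₖ| ≤ θ ^ k |Q|`, then `∑ χ_{Ωₖ}` has a bounded `exp L(Q)` norm, for any `θ < 1`; conversely
  `|f|` is dominated by a multiple of the sum of the indicators of its level sets at the heights
  `k t`, which decay geometrically by Chebyshev's inequality.
* From nested sets to sparse families (`SparseBound.of_nestedBound`): the set of points lying in
  more than `m` cubes of an `η`-sparse family has measure at most `(1 - η) ^ m |Q|`.
* From sparse families to `BMO` (`BMOEmbedding.of_sparseBound`): a stopping-time argument on the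
  dyadic averages of `f` yields a family `F` with `|f - ⟨f⟩_Q| ≤ c ‖f‖_BMO ∑_{P ∈ F} χ_P`. The
  family is `η`-sparse by the weak type `(1, 1)` estimate `volume_biUnion_closedBall_le`, a
  consequence of the Vitali covering lemma.
* From `BMO` to `exp L` (`ExpLEmbedding.of_bmoEmbedding`): if `∫_Q (e ^ (|f| / α) - 1) ≤ |Q|`, set
  `G = χ_Q (e ^ (|f| / α) - 1)`. By the Coifman–Rochberg theorem
  (`exists_lintegral_logMaximal_sub_le`) the logarithm of the maximal function of `G` has `BMO` norm
  bounded in terms of `n`, and it dominates `|f| / α` where it is large. After truncating it and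
  adding the indicator of a suitable set, one obtains `h` with `|f| / α ≤ c |h - ⟨h⟩_Q|` on all
  of `Q` (`exists_bmo_majorant`).
-/

/-! ### Geometry of cubes -/

namespace Cube

variable {n : ℕ}

lemma mem_toSet {Q : Cube n} {x : Fin n → ℝ} :
    x ∈ Q.toSet ↔ ∀ i, Q.corner i ≤ x i ∧ x i < Q.corner i + Q.side := by
  simp [toSet, Set.mem_pi]

lemma measurableSet_toSet (Q : Cube n) : MeasurableSet Q.toSet :=
  MeasurableSet.univ_pi fun _ => measurableSet_Ico

lemma volume_toSet (Q : Cube n) : volume Q.toSet = ENNReal.ofReal (Q.side ^ n) := by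
  rw [toSet, Real.volume_pi_Ico]
  simp [ENNReal.ofReal_pow Q.side_pos.le]

lemma volume_real_toSet (Q : Cube n) : volume.real Q.toSet = Q.side ^ n := by
  rw [Measure.real, volume_toSet, ENNReal.toReal_ofReal (pow_nonneg Q.side_pos.le n)]

lemma volume_toSet_ne_zero (Q : Cube n) : volume Q.toSet ≠ 0 := by
  rw [volume_toSet]
  simpa using pow_pos Q.side_pos n

lemma volume_toSet_ne_top (Q : Cube n) : volume Q.toSet ≠ ∞ := by
  rw [volume_toSet]
  exact ENNReal.ofReal_ne_top

lemma volume_real_toSet_pos (Q : Cube n) : 0 < volume.real Q.toSet := by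
  rw [volume_real_toSet]
  exact pow_pos Q.side_pos n

/-- The centre of a cube. -/
noncomputable def center (Q : Cube n) : Fin n → ℝ := fun i => Q.corner i + Q.side / 2

/-- In the sup metric of `Fin n → ℝ` a cube is, up to its boundary, a ball. -/
lemma toSet_subset_closedBall (Q : Cube n) :
    Q.toSet ⊆ Metric.closedBall Q.center (Q.side / 2) := by
  intro x hx
  rw [Metric.mem_closedBall, dist_pi_le_iff (by linarith [Q.side_pos])]
  intro i
  have := mem_toSet.1 hx i
  rw [Real.dist_eq, abs_le, center]
  constructor <;> linarith

lemma volume_closedBall_center (Q : Cube n) :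
    volume (Metric.closedBall Q.center (Q.side / 2)) = volume Q.toSet := by
  rw [volume_toSet, Real.volume_pi_closedBall _ (by linarith [Q.side_pos])]
  simp [mul_div_cancel₀]

lemma toSet_ae_eq_closedBall (Q : Cube n) :
    Q.toSet =ᵐ[volume] Metric.closedBall Q.center (Q.side / 2) :=
  ae_eq_of_subset_of_measure_ge Q.toSet_subset_closedBall Q.volume_closedBall_center.le
    Q.measurableSet_toSet.nullMeasurableSet
    (by rw [Q.volume_closedBall_center]; exact Q.volume_toSet_ne_top)

lemma child_subset (Q : Cube n) (ε : Fin n → Bool) : (Q.child ε).toSet ⊆ Q.toSet := by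
  intro x hx
  rw [mem_toSet] at hx ⊢
  intro i
  have h := hx i
  have := Q.side_pos
  simp only [child] at h
  split_ifs at h <;> constructor <;> linarith

/-- The child of `Q` that contains a given point `x` of `Q`. -/
noncomputable def next (Q : Cube n) (x : Fin n → ℝ) : Cube n :=
  Q.child fun i => decide (Q.corner i + Q.side / 2 ≤ x i)

lemma mem_next {Q : Cube n} {x : Fin n → ℝ} (hx : x ∈ Q.toSet) : x ∈ (Q.next x).toSet := by
  rw [mem_toSet] at hx ⊢
  intro i
  have h := hx i
  simp only [next, child, decide_eq_true_eq]
  split_ifs with h' <;> constructor <;> linarith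

lemma child_eq_next {Q : Cube n} {ε : Fin n → Bool} {x : Fin n → ℝ}
    (hx : x ∈ (Q.child ε).toSet) : Q.child ε = Q.next x := by
  rw [mem_toSet] at hx
  have : ε = fun i => decide (Q.corner i + Q.side / 2 ≤ x i) := by
    funext i
    have h := hx i
    have := Q.side_pos
    simp only [child] at h
    cases hε : ε i
    · simp only [hε, Bool.false_eq_true, if_false] at h
      symm
      rw [decide_eq_false_iff_not]
      linarith
    · simp only [hε, if_true] at h
      symm
      rw [decide_eq_true_eq]
      linarith
  rw [next, ← this]

/-- The dyadic subcube of `Q` of side length `2⁻ᵏ` times that of `Q` that contains a given point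
`x` of `Q`. -/
noncomputable def path (Q : Cube n) (x : Fin n → ℝ) : ℕ → Cube n
  | 0 => Q
  | k + 1 => (Q.path x k).next x

lemma path_succ (Q : Cube n) (x : Fin n → ℝ) (k : ℕ) :
    Q.path x (k + 1) = (Q.path x k).next x := rfl

lemma side_path (Q : Cube n) (x : Fin n → ℝ) (k : ℕ) : (Q.path x k).side = Q.side / 2 ^ k := by
  induction k with
  | zero => simp [path]
  | succ k ih =>
    rw [path_succ, next, child]
    simp only [ih, pow_succ]
    field_simp

lemma path_injective (Q : Cube n) (x : Fin n → ℝ) : Function.Injective (Q.path x) := by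
  intro j k h
  have h1 := congrArg Cube.side h
  rw [side_path, side_path] at h1
  have h2 := Q.side_pos.ne'
  field_simp at h1
  exact (pow_right_injective₀ (by norm_num) (by norm_num) h1).symm

lemma isDyadic_path (Q : Cube n) (x : Fin n → ℝ) (k : ℕ) : Q.path x k ∈ Q.dyadic := by
  induction k with
  | zero => exact IsDyadic.self
  | succ k ih => exact IsDyadic.child _ _ ih

lemma path_antitone (Q : Cube n) (x : Fin n → ℝ) : Antitone fun k => (Q.path x k).toSet :=
  antitone_nat_of_succ_le fun _ => child_subset _ _

lemma mem_path {Q : Cube n} {x : Fin n → ℝ} (hx : x ∈ Q.toSet) (k : ℕ) :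
    x ∈ (Q.path x k).toSet := by
  induction k with
  | zero => exact hx
  | succ k ih => exact mem_next ih

lemma path_subset (Q : Cube n) (x : Fin n → ℝ) (k : ℕ) : (Q.path x k).toSet ⊆ Q.toSet :=
  Q.path_antitone x (Nat.zero_le k)

lemma exists_eq_path {Q P : Cube n} (hP : P ∈ Q.dyadic) {x : Fin n → ℝ} (hx : x ∈ P.toSet) :
    ∃ k, P = Q.path x k := by
  induction hP with
  | self => exact ⟨0, rfl⟩
  | child P ε _ ih =>
    obtain ⟨k, hk⟩ := ih (P.child_subset ε hx)
    exact ⟨k + 1, by rw [path_succ, ← hk, child_eq_next hx]⟩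

lemma path_eq_of_mem {Q : Cube n} {x y : Fin n → ℝ} {k : ℕ} (hy : y ∈ (Q.path x k).toSet) :
    Q.path y k = Q.path x k := by
  induction k with
  | zero => rfl
  | succ k ih =>
    rw [path_succ, path_succ, ih (child_subset _ _ hy)]
    exact (child_eq_next hy).symm

lemma path_eq_of_mem_of_le {Q : Cube n} {x y : Fin n → ℝ} {j k : ℕ} (hjk : j ≤ k)
    (hy : y ∈ (Q.path x k).toSet) : Q.path y j = Q.path x j :=
  path_eq_of_mem (Q.path_antitone x hjk hy)

lemma dyadic_subset {Q P : Cube n} (hP : P ∈ Q.dyadic) : P.toSet ⊆ Q.toSet := by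
  induction hP with
  | self => exact subset_rfl
  | child P ε _ ih => exact (P.child_subset ε).trans ih

lemma countable_dyadic (Q : Cube n) : Q.dyadic.Countable := by
  let c : List (Fin n → Bool) → Cube n := fun l => l.foldr (fun ε P => P.child ε) Q
  refine (Set.countable_range c).mono fun P hP => ?_
  induction hP with
  | self => exact ⟨[], rfl⟩
  | child P ε _ ih =>
    obtain ⟨l, rfl⟩ := ih
    exact ⟨ε :: l, rfl⟩

lemma volume_real_path (Q : Cube n) (x : Fin n → ℝ) (k : ℕ) :
    volume.real (Q.path x k).toSet = 2 ^ n * volume.real (Q.path x (k + 1)).toSet := by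
  rw [volume_real_toSet, volume_real_toSet, side_path, side_path, ← mul_pow]
  congr 1
  rw [pow_succ]
  field_simp

lemma path_ssubset (hn : 0 < n) (Q : Cube n) (x : Fin n → ℝ) {j k : ℕ} (hjk : j < k) :
    (Q.path x k).toSet ⊂ (Q.path x j).toSet := by
  refine (Q.path_antitone x hjk.le).ssubset_of_ne fun h => ?_
  have h1 := congrArg volume.real h
  rw [volume_real_toSet, volume_real_toSet] at h1
  have h2 := (pow_left_inj₀ (Cube.side_pos _).le (Cube.side_pos _).le hn.ne').1 h1
  rw [side_path, side_path] at h2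
  have h3 := Q.side_pos.ne'
  field_simp at h2
  exact hjk.ne (pow_right_injective₀ (by norm_num) (by norm_num) h2)

end Cube

/-! ### A covering estimate -/

/-- The weak type `(1, 1)` estimate behind the Hardy–Littlewood maximal theorem, in terms of a
family of balls on which the averages of `G` are large. It follows from the Vitali covering
lemma. -/
lemma volume_biUnion_closedBall_le {n : ℕ} (hn : 0 < n) {ι : Type*} (t : Set ι)
    (x : ι → Fin n → ℝ) (r : ι → ℝ) (hr : ∀ a ∈ t, 0 < r a) (G : (Fin n → ℝ) → ℝ≥0∞)
    (lam : ℝ≥0∞) (hlam : lam ≠ 0)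
    (h : ∀ a ∈ t, lam * volume (Metric.closedBall (x a) (r a)) ≤
      ∫⁻ y in Metric.closedBall (x a) (r a), G y) :
    lam * volume (⋃ a ∈ t, Metric.closedBall (x a) (r a)) ≤ 5 ^ n * ∫⁻ y, G y := by
  rcases eq_or_ne (∫⁻ y, G y) ∞ with htop | htop
  · rw [htop, ENNReal.mul_top (by positivity)]
    exact le_top
  -- The radii are bounded since `lam * |B| ≤ ∫ G < ∞`.
  have hV : (∫⁻ y, G y) / lam ≠ ∞ := ENNReal.div_ne_top htop hlam
  have hbdd : ∀ a ∈ t, r a ≤ max 1 ((∫⁻ y, G y) / lam).toReal := by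
    intro a ha
    have h1 : volume (Metric.closedBall (x a) (r a)) ≤ (∫⁻ y, G y) / lam := by
      rw [ENNReal.le_div_iff_mul_le (Or.inl hlam) (Or.inr htop), mul_comm]
      exact (h a ha).trans (setLIntegral_le_lintegral _ _)
    rw [Real.volume_pi_closedBall _ (hr a ha).le, Fintype.card_fin,
      ENNReal.ofReal_le_iff_le_toReal hV] at h1
    rcases le_total (r a) 1 with h2 | h2
    · exact h2.trans (le_max_left _ _)
    · refine le_trans ?_ (h1.trans (le_max_right _ _))
      calc r a ≤ 2 * r a := by linarith
        _ ≤ (2 * r a) ^ n := le_self_pow₀ (by linarith) hn.ne'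
  obtain ⟨u, hut, hdisj, hcov⟩ :=
    Vitali.exists_disjoint_subfamily_covering_enlargement_closedBall t x r _ hbdd 5 (by norm_num)
  have hu : u.Countable := hdisj.countable_of_nonempty_interior fun a ha =>
    ⟨x a, Metric.ball_subset_interior_closedBall (Metric.mem_ball_self (hr a (hut ha)))⟩
  have hscale : ∀ a ∈ u, volume (Metric.closedBall (x a) (5 * r a)) =
      5 ^ n * volume (Metric.closedBall (x a) (r a)) := by
    intro a ha
    have h0 := (hr a (hut ha)).le
    rw [Real.volume_pi_closedBall _ h0, Real.volume_pi_closedBall _ (by positivity),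
      Fintype.card_fin, show 2 * (5 * r a) = 5 * (2 * r a) by ring, mul_pow,
      ENNReal.ofReal_mul (by positivity), ENNReal.ofReal_pow (by norm_num)]
    simp
  have : Countable u := hu.to_subtype
  calc lam * volume (⋃ a ∈ t, Metric.closedBall (x a) (r a))
      ≤ lam * volume (⋃ a ∈ u, Metric.closedBall (x a) (5 * r a)) := by
        refine mul_le_mul_right (measure_mono (iUnion₂_subset fun a ha => ?_)) _
        obtain ⟨b, hb, hab⟩ := hcov a ha
        exact hab.trans (subset_biUnion_of_mem (u := fun b => Metric.closedBall (x b) (5 * r b)) hb)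
    _ ≤ lam * ∑' a : u, volume (Metric.closedBall (x a) (5 * r a)) := by
        gcongr
        exact measure_biUnion_le volume hu _
    _ = 5 ^ n * ∑' a : u, lam * volume (Metric.closedBall (x a) (r a)) := by
        rw [ENNReal.tsum_mul_left, tsum_congr fun a : u => hscale a a.2, ENNReal.tsum_mul_left]
        ring
    _ ≤ 5 ^ n * ∑' a : u, ∫⁻ y in Metric.closedBall (x a) (r a), G y := by
        gcongr with a
        exact h a (hut a.2)
    _ = 5 ^ n * ∫⁻ y in ⋃ a ∈ u, Metric.closedBall (x a) (r a), G y := by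
        rw [lintegral_biUnion hu (fun a _ => Metric.isClosed_closedBall.measurableSet) hdisj]
    _ ≤ 5 ^ n * ∫⁻ y, G y := by
        exact mul_le_mul_right (setLIntegral_le_lintegral _ _) _

/-! ### Sums of indicator functions and exponential integrability -/

lemma measurable_tsum_indicator {α ι : Type*} [MeasurableSpace α] [Countable ι] {s : ι → Set α}
    (hs : ∀ i, MeasurableSet (s i)) :
    Measurable fun x => ∑' i, (s i).indicator (fun _ => (1 : ℝ)) x :=
  Measurable.tsum fun i => measurable_const.indicator (hs i)

lemma tsum_indicator_one_nonneg {α ι : Type*} (s : ι → Set α) (x : α) :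
    0 ≤ ∑' i, (s i).indicator (fun _ => (1 : ℝ)) x :=
  tsum_nonneg fun _ => indicator_nonneg (fun _ _ => zero_le_one) _

lemma natCast_le_tsum_indicator {α : Type*} {Ω : ℕ → Set α} {x : α} {c M : ℕ}
    (hc : ∀ m < c, x ∈ Ω m) (hM : ∀ m, M ≤ m → x ∉ Ω m) :
    (c : ℝ) ≤ ∑' k, (Ω k).indicator (fun _ => (1 : ℝ)) x := by
  have hsum : Summable fun k => (Ω k).indicator (fun _ => (1 : ℝ)) x :=
    summable_of_ne_finset_zero (s := Finset.range M) fun k hk => by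
      simpa using hM k (by simpa using hk)
  calc (c : ℝ) = ∑ k ∈ Finset.range c, (Ω k).indicator (fun _ => (1 : ℝ)) x := by
        rw [Finset.sum_congr rfl fun k hk =>
          indicator_of_mem (hc k (Finset.mem_range.1 hk)) _]
        simp
    _ ≤ _ := hsum.sum_le_tsum _ fun k _ => indicator_nonneg (fun _ _ => zero_le_one) _

/-- For a decreasing sequence of sets, the sum of the indicators at `x` is either divergent, with
junk value `0`, or the number of sets containing `x`; in both cases a weighted sum controls the
exponential of it. -/
lemma ofReal_pow_tsum_indicator_sub_one_le {α : Type*} {Ω : ℕ → Set α}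
    (hanti : ∀ k, Ω (k + 1) ⊆ Ω k) {s : ℝ} (hs : 1 ≤ s) (x : α) :
    ENNReal.ofReal (s ^ (∑' k, (Ω k).indicator (fun _ => (1 : ℝ)) x) - 1) ≤
      ∑' k, (Ω k).indicator (fun _ => ENNReal.ofReal ((s - 1) * s ^ k)) x := by
  have hA : Antitone Ω := antitone_nat_of_succ_le hanti
  by_cases h : ∀ k, x ∈ Ω k
  · have h1 : ∑' k, (Ω k).indicator (fun _ => (1 : ℝ)) x = 0 := by
      refine tsum_eq_zero_of_not_summable fun hsum => ?_
      have := hsum.tendsto_atTop_zero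
      simp only [indicator_of_mem (h _), tendsto_const_nhds_iff] at this
      exact one_ne_zero this
    simp [h1]
  · push Not at h
    classical
    obtain ⟨M, hM, hlt⟩ : ∃ M, x ∉ Ω M ∧ ∀ m < M, x ∈ Ω m :=
      ⟨Nat.find h, Nat.find_spec h, fun m hm => not_not.1 (Nat.find_min h hm)⟩
    have hge : ∀ m, M ≤ m → x ∉ Ω m := fun m hm hx => hM (hA hm hx)
    have h1 : ∑' k, (Ω k).indicator (fun _ => (1 : ℝ)) x = M := by
      rw [tsum_eq_sum (s := Finset.range M) fun k hk =>
        indicator_of_notMem (hge k (by simpa using hk)) _,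
        Finset.sum_congr rfl fun k hk => indicator_of_mem (hlt k (Finset.mem_range.1 hk)) _]
      simp
    rw [h1, Real.rpow_natCast]
    calc ENNReal.ofReal (s ^ M - 1)
        = ENNReal.ofReal (∑ k ∈ Finset.range M, (s - 1) * s ^ k) := by
          rw [← Finset.mul_sum, mul_comm, geom_sum_mul]
      _ = ∑ k ∈ Finset.range M, ENNReal.ofReal ((s - 1) * s ^ k) :=
          ENNReal.ofReal_sum_of_nonneg fun k _ =>
            mul_nonneg (by linarith) (pow_nonneg (by linarith) _)
      _ = ∑ k ∈ Finset.range M, (Ω k).indicator (fun _ => ENNReal.ofReal ((s - 1) * s ^ k)) x :=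
          Finset.sum_congr rfl fun k hk =>
            (indicator_of_mem (hlt k (Finset.mem_range.1 hk))
              (fun _ => ENNReal.ofReal ((s - 1) * s ^ k))).symm
      _ ≤ _ := ENNReal.sum_le_tsum _

lemma expLNorm_le {n : ℕ} {Q : Cube n} {f : (Fin n → ℝ) → ℝ} {α : ℝ} (hα : 0 < α)
    (h : ∫⁻ x in Q.toSet, ENNReal.ofReal (Real.exp (|f x| / α) - 1) ≤ volume Q.toSet) :
    expLNorm Q f ≤ ENNReal.ofReal α := by
  refine iInf₂_le α ⟨hα, ?_⟩
  rw [← ENNReal.inv_mul_cancel Q.volume_toSet_ne_zero Q.volume_toSet_ne_top]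
  exact mul_le_mul_right h _

lemma volume_le_of_real_le {n : ℕ} {Q : Cube n} {s : Set (Fin n → ℝ)} (hs : s ⊆ Q.toSet)
    {c : ℝ} (hc : 0 ≤ c) (h : volume.real s ≤ c * volume.real Q.toSet) :
    volume s ≤ ENNReal.ofReal c * volume Q.toSet := by
  have hfin : volume s ≠ ∞ := ne_top_of_le_ne_top Q.volume_toSet_ne_top (measure_mono hs)
  rw [← ENNReal.ofReal_toReal hfin, ← ENNReal.ofReal_toReal Q.volume_toSet_ne_top,
    ← ENNReal.ofReal_mul hc]
  exact ENNReal.ofReal_le_ofReal h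

/-- If `|Ω k| ≤ θ ^ k |Q|`, then `∑ₖ χ_{Ω k}` is exponentially integrable on `Q`. -/
lemma expLNorm_tsum_indicator_le {n : ℕ} {θ : ℝ} (hθ : θ ∈ Ioo (0 : ℝ) 1) (Q : Cube n)
    (Ω : ℕ → Set (Fin n → ℝ)) (hm : ∀ k, MeasurableSet (Ω k)) (hQ : ∀ k, Ω k ⊆ Q.toSet)
    (hanti : ∀ k, Ω (k + 1) ⊆ Ω k)
    (hvol : ∀ k, volume.real (Ω k) ≤ θ ^ k * volume.real Q.toSet) :
    expLNorm Q (fun x => ∑' k, (Ω k).indicator (fun _ => (1 : ℝ)) x) ≤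
      ENNReal.ofReal (Real.log (2 / (1 + θ)))⁻¹ := by
  obtain ⟨hθ0, hθ1⟩ := hθ
  -- With `s = 2 / (1 + θ)` the geometric series below has sum `(s - 1) / (1 - s θ) = 1`.
  set s : ℝ := 2 / (1 + θ) with hs
  have hs1 : 1 < s := by rw [hs, lt_div_iff₀ (by linarith)]; linarith
  have hsθ : s * θ < 1 := by rw [hs, div_mul_eq_mul_div, div_lt_one (by linarith)]; linarith
  have hlog : 0 < Real.log s := Real.log_pos hs1
  refine expLNorm_le (inv_pos.2 hlog) ?_
  calc ∫⁻ x in Q.toSet, ENNReal.ofReal (Real.exp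
          (|∑' k, (Ω k).indicator (fun _ => (1 : ℝ)) x| / (Real.log s)⁻¹) - 1)
      ≤ ∫⁻ x in Q.toSet, ∑' k, (Ω k).indicator (fun _ => ENNReal.ofReal ((s - 1) * s ^ k)) x := by
        refine lintegral_mono fun x => ?_
        refine le_trans (le_of_eq ?_) (ofReal_pow_tsum_indicator_sub_one_le hanti hs1.le x)
        rw [abs_of_nonneg (tsum_indicator_one_nonneg _ _), div_inv_eq_mul, mul_comm,
          Real.rpow_def_of_pos (by linarith)]
    _ = ∑' k, ENNReal.ofReal ((s - 1) * s ^ k) * volume (Ω k) := by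
        rw [lintegral_tsum fun k => (measurable_const.indicator (hm k)).aemeasurable]
        refine tsum_congr fun k => ?_
        rw [lintegral_indicator_const (hm k), Measure.restrict_apply (hm k),
          inter_eq_left.2 (hQ k)]
    _ ≤ ∑' k, ENNReal.ofReal ((s - 1) * (s * θ) ^ k) * volume Q.toSet := by
        refine ENNReal.tsum_le_tsum fun k => ?_
        have h1 : 0 ≤ (s - 1) * s ^ k := mul_nonneg (by linarith) (pow_nonneg (by linarith) _)
        refine (mul_le_mul_right (volume_le_of_real_le (hQ k) (pow_nonneg hθ0.le k) (hvol k))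
          _).trans (le_of_eq ?_)
        rw [← mul_assoc, ← ENNReal.ofReal_mul h1, mul_pow, mul_assoc]
    _ = volume Q.toSet := by
        have h0 : 0 ≤ s * θ := mul_nonneg (by linarith) hθ0.le
        have hg := (hasSum_geometric_of_lt_one h0 hsθ).mul_left (s - 1)
        rw [ENNReal.tsum_mul_right, ← ENNReal.ofReal_tsum_of_nonneg
          (fun k => mul_nonneg (by linarith) (pow_nonneg h0 _)) hg.summable, hg.tsum_eq]
        have : (s - 1) * (1 - s * θ)⁻¹ = 1 := by
          rw [← div_eq_mul_inv, div_eq_one_iff_eq (by linarith), hs]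
          field_simp
          ring
        rw [this, ENNReal.ofReal_one, one_mul]

lemma NestedBound.of_expLEmbedding {n : ℕ} {θ : ℝ} (hθ : θ ∈ Ioo (0 : ℝ) 1)
    {X : FunctionSpaceFamily n} {C : ℝ≥0} (h : ExpLEmbedding X C) :
    NestedBound θ X (Real.toNNReal (Real.log (2 / (1 + θ)))⁻¹ * C) := by
  intro Q Ω hm hQ hanti hvol
  have hnorm := expLNorm_tsum_indicator_le hθ Q Ω hm hQ hanti hvol
  refine (h Q _ (measurable_tsum_indicator hm).aemeasurable
    (hnorm.trans_lt ENNReal.ofReal_lt_top)).trans ?_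
  rw [ENNReal.coe_mul, mul_comm]
  exact mul_le_mul_left hnorm _

/-- To bound `‖f‖_{X_Q}` by the `exp L(Q)` norm it suffices to consider each `α` that competes in
the Luxemburg infimum. -/
lemma ExpLEmbedding.of_forall {n : ℕ} {X : FunctionSpaceFamily n} {C : ℝ≥0} (hC : C ≠ 0)
    (h : ∀ (Q : Cube n) (f : (Fin n → ℝ) → ℝ), AEMeasurable f (volume.restrict Q.toSet) →
      ∀ α : ℝ, 0 < α →
      ∫⁻ x in Q.toSet, ENNReal.ofReal (Real.exp (|f x| / α) - 1) ≤ volume Q.toSet →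
      (X Q).nrm f ≤ C * ENNReal.ofReal α) : ExpLEmbedding X C := by
  intro Q f hf _
  have hC0 : (C : ℝ≥0∞) ≠ 0 := ENNReal.coe_ne_zero.2 hC
  rw [expLNorm, luxemburgNorm, ENNReal.mul_iInf_of_ne hC0 ENNReal.coe_ne_top]
  refine le_iInf fun α => ?_
  rw [ENNReal.mul_iInf_of_ne hC0 ENNReal.coe_ne_top]
  refine le_iInf fun hα => h Q f hf α hα.1 ?_
  have h1 := mul_le_mul_right hα.2 (volume Q.toSet)
  rwa [← mul_assoc, ENNReal.mul_inv_cancel Q.volume_toSet_ne_zero Q.volume_toSet_ne_top,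
    one_mul, mul_one] at h1

lemma QuasiBanachFunctionSpace.nrm_le_of_abs_le {α : Type*} [MeasurableSpace α] {μ : Measure α}
    (Y : QuasiBanachFunctionSpace μ) {f g : α → ℝ} (hf : AEMeasurable f μ) {c : ℝ} (hc : 0 ≤ c)
    (h : ∀ᵐ x ∂μ, |f x| ≤ c * |g x|) : Y.nrm f ≤ ENNReal.ofReal c * Y.nrm g := by
  refine (Y.nrm_mono f (c • g) hf ?_).trans (le_of_eq ?_)
  · filter_upwards [h] with x hx
    rwa [Pi.smul_apply, smul_eq_mul, abs_mul, abs_of_nonneg hc]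
  · rw [Y.nrm_smul, Real.enorm_of_nonneg hc]

/-- If `α` competes in the Luxemburg infimum of `f`, the level sets of `f` at the heights `k t`,
`t = α log (2 / γ)`, decay like `γ ^ k`, and `|f|` is at most `t` times the sum of their
indicators. -/
lemma ExpLEmbedding.of_nestedBound {n : ℕ} {γ : ℝ} (hγ : γ ∈ Ioo (0 : ℝ) 1)
    {X : FunctionSpaceFamily n} {C : ℝ≥0} (hC : C ≠ 0) (h : NestedBound γ X C) :
    ExpLEmbedding X (Real.toNNReal (Real.log (2 / γ)) * C) := by
  obtain ⟨hγ0, hγ1⟩ := hγ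
  have hγ2 : 1 < 2 / γ := by rw [lt_div_iff₀ hγ0]; linarith
  have hlog : 0 < Real.log (2 / γ) := Real.log_pos hγ2
  refine ExpLEmbedding.of_forall (mul_ne_zero (Real.toNNReal_pos.2 hlog).ne' hC)
    fun Q f hf α hα hint => ?_
  set t : ℝ := α * Real.log (2 / γ) with ht
  have ht0 : 0 < t := mul_pos hα hlog
  set g := hf.mk f with hg
  have hgm : Measurable g := hf.measurable_mk
  have hfg : f =ᵐ[volume.restrict Q.toSet] g := hf.ae_eq_mk
  let Ω : ℕ → Set (Fin n → ℝ) := fun k => {x | k * t < |g x|} ∩ Q.toSet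
  have hΩm : ∀ k, MeasurableSet (Ω k) := fun k =>
    (measurableSet_lt measurable_const hgm.abs).inter Q.measurableSet_toSet
  have hint' : ∫⁻ x in Q.toSet, ENNReal.ofReal (Real.exp (|g x| / α) - 1) ≤ volume Q.toSet := by
    refine le_trans (le_of_eq (lintegral_congr_ae ?_)) hint
    filter_upwards [hfg] with x hx
    rw [hx]
  have hvol : ∀ k, volume.real (Ω k) ≤ γ ^ k * volume.real Q.toSet := by
    intro k
    rcases Nat.eq_zero_or_pos k with rfl | hk
    · rw [pow_zero, one_mul]
      exact measureReal_mono inter_subset_right Q.volume_toSet_ne_top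
    -- Chebyshev's inequality; on `Ω k` the integrand is at least `(2 / γ) ^ k - 1 ≥ γ⁻¹ ^ k`.
    have hpow : (γ ^ k)⁻¹ ≤ (2 / γ) ^ k - 1 := by
      rw [div_pow, le_sub_iff_add_le, le_div_iff₀ (by positivity), add_mul,
        inv_mul_cancel₀ (by positivity), one_mul]
      have h1 : γ ^ k ≤ 1 := pow_le_one₀ hγ0.le hγ1.le
      have h2 : (2 : ℝ) ≤ 2 ^ k := le_self_pow₀ (by norm_num) hk.ne'
      linarith
    have hle : ENNReal.ofReal (γ ^ k)⁻¹ * volume (Ω k) ≤ volume Q.toSet := by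
      calc ENNReal.ofReal (γ ^ k)⁻¹ * volume (Ω k)
          = ∫⁻ x in Ω k, ENNReal.ofReal (γ ^ k)⁻¹ := (setLIntegral_const _ _).symm
        _ ≤ ∫⁻ x in Ω k, ENNReal.ofReal (Real.exp (|g x| / α) - 1) := by
            refine setLIntegral_mono' (hΩm k) fun x hx => ENNReal.ofReal_le_ofReal ?_
            refine hpow.trans (sub_le_sub_right ?_ 1)
            have hx1 : k * t < |g x| := hx.1
            rw [← Real.exp_log (by positivity : (0 : ℝ) < (2 / γ) ^ k), Real.log_pow]
            refine Real.exp_le_exp.2 ?_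
            rw [le_div_iff₀ hα]
            calc k * Real.log (2 / γ) * α = k * t := by rw [ht]; ring
              _ ≤ |g x| := hx1.le
        _ ≤ _ := (lintegral_mono_set inter_subset_right).trans hint'
    have h2 := ENNReal.toReal_mono Q.volume_toSet_ne_top hle
    rw [ENNReal.toReal_mul, ENNReal.toReal_ofReal (by positivity)] at h2
    rwa [inv_mul_le_iff₀ (by positivity)] at h2
  have hB := h Q Ω hΩm (fun k => inter_subset_right)
    (fun k x hx => ⟨lt_of_le_of_lt
      (mul_le_mul_of_nonneg_right (by push_cast; linarith) ht0.le) hx.1, hx.2⟩) hvol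
  refine ((X Q).nrm_le_of_abs_le hf ht0.le ?_).trans (mul_le_mul_right hB _) |>.trans ?_
  · filter_upwards [hfg, ae_restrict_mem Q.measurableSet_toSet] with x hx hxQ
    rw [hx, abs_of_nonneg (tsum_indicator_one_nonneg _ _)]
    rw [← div_le_iff₀' ht0]
    refine (Nat.le_ceil _).trans (natCast_le_tsum_indicator (M := ⌈|g x| / t⌉₊) ?_ ?_)
    · intro m hm
      exact ⟨(lt_div_iff₀ ht0).1 (Nat.lt_ceil.1 hm), hxQ⟩
    · intro m hm hmem
      exact absurd ((lt_div_iff₀ ht0).2 hmem.1) (not_lt.2 (Nat.ceil_le.1 hm))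
  · rw [ht, ENNReal.ofReal_mul hα.le, ENNReal.coe_mul, ENNReal.ofNNReal_toNNReal]
    refine le_of_eq ?_
    ring

/-! ### Overlap of sparse families -/

section SparseOverlap

variable {n : ℕ}

open Classical in
/-- The number of cubes of `F` among the `k` largest dyadic subcubes of `Q` containing `x`, for
`x ∈ Q`. -/
noncomputable def overlapCount (F : Set (Cube n)) (Q : Cube n) (x : Fin n → ℝ) (k : ℕ) : ℕ :=
  Nat.count (fun j => Q.path x j ∈ F) k

/-- The set of points of `Q` lying in more than `m` cubes of a family `F` of dyadic subcubes of
`Q`. -/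
def overlapSet (F : Set (Cube n)) (Q : Cube n) (m : ℕ) : Set (Fin n → ℝ) :=
  {x | x ∈ Q.toSet ∧ ∃ k, m < overlapCount F Q x k}

/-- The cubes of a family `F` of dyadic subcubes of `Q` that are contained strictly in exactly `m`
cubes of `F`. -/
def generation (F : Set (Cube n)) (Q : Cube n) (m : ℕ) : Set (Cube n) :=
  {P | P ∈ F ∧ ∃ x ∈ Q.toSet, ∃ k, P = Q.path x k ∧ overlapCount F Q x k = m}

variable {F : Set (Cube n)} {Q : Cube n}

lemma overlapCount_mono (x : Fin n → ℝ) : Monotone (overlapCount F Q x) := by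
  classical
  exact Nat.count_monotone _

lemma overlapCount_succ_of_mem {x : Fin n → ℝ} {k : ℕ} (h : Q.path x k ∈ F) :
    overlapCount F Q x (k + 1) = overlapCount F Q x k + 1 := by
  classical
  rw [overlapCount, Nat.count_succ, if_pos h, overlapCount]

lemma overlapCount_congr {x y : Fin n → ℝ} {k : ℕ} (hy : y ∈ (Q.path x k).toSet) :
    overlapCount F Q y k = overlapCount F Q x k := by
  classical
  rw [overlapCount, overlapCount, Nat.count_eq_card_filter_range, Nat.count_eq_card_filter_range]
  congr 1
  refine Finset.filter_congr fun j hj => ?_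
  rw [Cube.path_eq_of_mem_of_le (Finset.mem_range.1 hj).le hy]

/-- The cube of generation `m` containing a given point of `overlapSet F Q m`. -/
lemma exists_path_of_mem_overlapSet {m : ℕ} {x : Fin n → ℝ} (hx : x ∈ overlapSet F Q m) :
    ∃ k, Q.path x k ∈ F ∧ overlapCount F Q x k = m := by
  classical
  obtain ⟨_, k, hk⟩ := hx
  induction k with
  | zero => simp [overlapCount] at hk
  | succ k ih =>
    by_cases h : m < overlapCount F Q x k
    · exact ih h
    · rw [overlapCount, Nat.count_succ, ← overlapCount] at hk
      split_ifs at hk with h'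
      · exact ⟨k, h', by omega⟩
      · omega

lemma overlapSet_eq_biUnion (m : ℕ) :
    overlapSet F Q m = ⋃ P ∈ generation F Q m, P.toSet := by
  ext x
  simp only [mem_iUnion, exists_prop]
  constructor
  · intro hx
    obtain ⟨k, hk, hc⟩ := exists_path_of_mem_overlapSet hx
    exact ⟨Q.path x k, ⟨hk, x, hx.1, k, rfl, hc⟩, Cube.mem_path hx.1 k⟩
  · rintro ⟨P, ⟨hP, y, hy, k, rfl, hc⟩, hx⟩
    have hxk := Cube.path_eq_of_mem hx
    refine ⟨Q.path_subset y k hx, k + 1, ?_⟩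
    rw [overlapCount_succ_of_mem (by rwa [hxk]), overlapCount_congr hx, hc]
    exact Nat.lt_succ_self m

lemma generation_subset_dyadic (m : ℕ) : generation F Q m ⊆ Q.dyadic := by
  rintro P ⟨_, x, _, k, rfl, _⟩
  exact Q.isDyadic_path x k

lemma countable_generation (m : ℕ) : (generation F Q m).Countable :=
  Q.countable_dyadic.mono (generation_subset_dyadic m)

lemma generation_pairwiseDisjoint (m : ℕ) :
    (generation F Q m).PairwiseDisjoint Cube.toSet := by
  rintro P ⟨hP, y, _, j, rfl, hj⟩ P' ⟨hP', z, _, k, rfl, hk⟩ hne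
  refine Set.disjoint_left.2 fun x hx hx' => hne ?_
  have h1 := Cube.path_eq_of_mem hx
  have h2 := Cube.path_eq_of_mem hx'
  rw [← overlapCount_congr hx] at hj
  rw [← overlapCount_congr hx'] at hk
  rw [← h1] at hP ⊢
  rw [← h2] at hP' ⊢
  rcases lt_trichotomy j k with h | rfl | h
  · have := overlapCount_mono (F := F) (Q := Q) x (Nat.succ_le_of_lt h)
    rw [Nat.succ_eq_add_one, overlapCount_succ_of_mem hP] at this
    omega
  · rfl
  · have := overlapCount_mono (F := F) (Q := Q) x (Nat.succ_le_of_lt h)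
    rw [Nat.succ_eq_add_one, overlapCount_succ_of_mem hP'] at this
    omega

lemma measurableSet_overlapSet (m : ℕ) : MeasurableSet (overlapSet F Q m) := by
  rw [overlapSet_eq_biUnion]
  exact MeasurableSet.biUnion (countable_generation m) fun P _ => P.measurableSet_toSet

lemma overlapSet_subset (m : ℕ) : overlapSet F Q m ⊆ Q.toSet := fun _ hx => hx.1

lemma overlapSet_succ_subset (m : ℕ) : overlapSet F Q (m + 1) ⊆ overlapSet F Q m :=
  fun _ hx => ⟨hx.1, hx.2.imp fun _ hk => (Nat.lt_succ_self m).trans hk⟩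

lemma measurableSet_sparsePart (hF : F ⊆ Q.dyadic) (P : Cube n) :
    MeasurableSet (sparsePart F P) :=
  P.measurableSet_toSet.diff <| MeasurableSet.biUnion
    (Q.countable_dyadic.mono fun _ h => hF h.1) fun P' _ => P'.measurableSet_toSet

lemma sparsePart_subset (P : Cube n) : sparsePart F P ⊆ P.toSet := sdiff_subset

/-- A point in more than `m + 1` cubes of `F` lies in a cube `P` of generation `m` and in a
strictly smaller cube of `F`. -/
lemma overlapSet_succ_subset_biUnion (hn : 0 < n) (m : ℕ) :
    overlapSet F Q (m + 1) ⊆ ⋃ P ∈ generation F Q m, P.toSet \ sparsePart F P := by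
  intro x hx
  obtain ⟨k, hk, hc⟩ := exists_path_of_mem_overlapSet (overlapSet_succ_subset m hx)
  obtain ⟨j, hj, hcj⟩ := exists_path_of_mem_overlapSet hx
  have hkj : k < j := by
    by_contra! h
    have := overlapCount_mono (F := F) (Q := Q) x h
    omega
  refine mem_biUnion (show Q.path x k ∈ generation F Q m from ⟨hk, x, hx.1, k, rfl, hc⟩)
    ⟨Cube.mem_path hx.1 k, fun h => h.2 ?_⟩
  exact mem_biUnion (show Q.path x j ∈ {P' ∈ F | P'.toSet ⊂ (Q.path x k).toSet} from
    ⟨hj, Cube.path_ssubset hn Q x hkj⟩) (Cube.mem_path hx.1 j)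

lemma volume_overlapSet_succ_le (hn : 0 < n) {η : ℝ} (hη : η < 1) (hF : F ⊆ Q.dyadic)
    (hs : IsSparse η F) (m : ℕ) :
    volume (overlapSet F Q (m + 1)) ≤ ENNReal.ofReal (1 - η) * volume (overlapSet F Q m) := by
  have hP : ∀ P ∈ F, volume (P.toSet \ sparsePart F P) ≤
      ENNReal.ofReal (1 - η) * volume P.toSet := by
    intro P hP
    refine volume_le_of_real_le sdiff_subset (by linarith) ?_
    rw [measureReal_sdiff (sparsePart_subset P) (measurableSet_sparsePart hF P)
      P.volume_toSet_ne_top]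
    linarith [hs P hP]
  calc volume (overlapSet F Q (m + 1))
      ≤ volume (⋃ P ∈ generation F Q m, P.toSet \ sparsePart F P) :=
        measure_mono (overlapSet_succ_subset_biUnion hn m)
    _ ≤ ∑' P : generation F Q m, volume (P.1.toSet \ sparsePart F P.1) :=
        measure_biUnion_le volume (countable_generation m) _
    _ ≤ ∑' P : generation F Q m, ENNReal.ofReal (1 - η) * volume P.1.toSet :=
        ENNReal.tsum_le_tsum fun P => hP P.1 P.2.1
    _ = ENNReal.ofReal (1 - η) * volume (overlapSet F Q m) := by
        rw [ENNReal.tsum_mul_left, overlapSet_eq_biUnion,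
          measure_biUnion (countable_generation m) (generation_pairwiseDisjoint m)
            fun P _ => P.measurableSet_toSet]

lemma volume_overlapSet_le (hn : 0 < n) {η : ℝ} (hη : η < 1) (hF : F ⊆ Q.dyadic)
    (hs : IsSparse η F) (m : ℕ) :
    volume (overlapSet F Q m) ≤ ENNReal.ofReal (1 - η) ^ m * volume Q.toSet := by
  induction m with
  | zero => simpa using measure_mono (overlapSet_subset 0)
  | succ m ih =>
    refine (volume_overlapSet_succ_le hn hη hF hs m).trans ?_
    rw [pow_succ', mul_assoc]
    exact mul_le_mul_right ih _

/-- Almost every point lies in only finitely many cubes of a sparse family. -/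
lemma ae_exists_notMem_overlapSet (hn : 0 < n) {η : ℝ} (hη : η ∈ Ioo (0 : ℝ) 1)
    (hF : F ⊆ Q.dyadic) (hs : IsSparse η F) :
    ∀ᵐ x, ∃ M, x ∉ overlapSet F Q M := by
  rw [ae_iff]
  push Not
  have hlt : ENNReal.ofReal (1 - η) < 1 := by
    rw [ENNReal.ofReal_lt_one]
    linarith [hη.1]
  have h0 : Tendsto (fun m : ℕ => ENNReal.ofReal (1 - η) ^ m * volume Q.toSet) atTop (𝓝 0) := by
    simpa using ENNReal.Tendsto.mul_const (ENNReal.tendsto_pow_atTop_nhds_zero_of_lt_one hlt)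
      (Or.inr Q.volume_toSet_ne_top)
  refine le_antisymm (ge_of_tendsto' h0 fun m => ?_) zero_le
  exact (measure_mono fun x (hx : ∀ M, x ∈ overlapSet F Q M) => hx m).trans
    (volume_overlapSet_le hn hη.2 hF hs m)

/-- The overlap of a family of dyadic cubes is dominated by the sum of the indicators of its
overlap sets, at points where it is finite. -/
lemma tsum_indicator_le_tsum_overlapSet (hF : F ⊆ Q.dyadic) {x : Fin n → ℝ} (hx : x ∈ Q.toSet)
    (hM : ∃ M, x ∉ overlapSet F Q M) :
    ∑' P : F, P.1.toSet.indicator (fun _ => (1 : ℝ)) x ≤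
      ∑' m, (overlapSet F Q m).indicator (fun _ => (1 : ℝ)) x := by
  classical
  obtain ⟨M, hM⟩ := hM
  refine Real.tsum_le_of_sum_le (fun _ => indicator_nonneg (fun _ _ => zero_le_one) _) fun S => ?_
  let S' : Finset F := S.filter fun P => x ∈ P.1.toSet
  have hS' : ∀ P ∈ S', x ∈ P.1.toSet := fun P hP => (Finset.mem_filter.1 hP).2
  have hpath : ∀ P : F, ∃ k, P ∈ S' → P.1 = Q.path x k := by
    intro P
    by_cases hP : P ∈ S'
    · obtain ⟨k, hk⟩ := Cube.exists_eq_path (hF P.2) (hS' P hP)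
      exact ⟨k, fun _ => hk⟩
    · exact ⟨0, fun h => absurd h hP⟩
  choose g hg using hpath
  obtain ⟨K, hK⟩ : ∃ K, ∀ P ∈ S', g P < K :=
    ⟨S'.sup g + 1, fun P hP => Nat.lt_succ_of_le (Finset.le_sup (f := g) hP)⟩
  have hcard : S'.card ≤ overlapCount F Q x K := by
    rw [overlapCount, Nat.count_eq_card_filter_range]
    refine Finset.card_le_card_of_injOn g (fun P hP => ?_) fun P hP P' hP' h => ?_
    · refine Finset.mem_coe.2 (Finset.mem_filter.2 ⟨Finset.mem_range.2 (hK P hP), ?_⟩)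
      rw [← hg P hP]
      exact P.2
    · exact Subtype.ext (by rw [hg P hP, hg P' hP', h])
  calc ∑ P ∈ S, P.1.toSet.indicator (fun _ => (1 : ℝ)) x = (S'.card : ℝ) := by
        simp only [indicator_apply]
        rw [Finset.sum_boole]
    _ ≤ (overlapCount F Q x K : ℝ) := by exact_mod_cast hcard
    _ ≤ _ := natCast_le_tsum_indicator (Ω := overlapSet F Q) (fun m hm => ⟨hx, K, hm⟩)
        fun m hm hmem => hM (antitone_nat_of_succ_le overlapSet_succ_subset hm hmem)

lemma SparseBound.of_nestedBound (hn : 0 < n) {η : ℝ} (hη : η ∈ Ioo (0 : ℝ) 1)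
    {X : FunctionSpaceFamily n} {C : ℝ≥0} (h : NestedBound (1 - η) X C) : SparseBound η X C := by
  intro Q F hF hs
  have hvol : ∀ m, volume.real (overlapSet F Q m) ≤ (1 - η) ^ m * volume.real Q.toSet := by
    intro m
    have h1 := volume_overlapSet_le hn hη.2 hF hs m
    have h2 := ENNReal.toReal_mono (ENNReal.mul_ne_top (by simp) Q.volume_toSet_ne_top) h1
    rwa [ENNReal.toReal_mul, ENNReal.toReal_pow,
      ENNReal.toReal_ofReal (by linarith [hη.2])] at h2
  have : Countable F := (Q.countable_dyadic.mono hF).to_subtype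
  refine ((X Q).nrm_mono _ _ ?_ ?_).trans (h Q (overlapSet F Q) measurableSet_overlapSet
    overlapSet_subset overlapSet_succ_subset hvol)
  · exact (measurable_tsum_indicator fun P : F => P.1.measurableSet_toSet).aemeasurable
  · filter_upwards [ae_restrict_mem Q.measurableSet_toSet,
      ae_restrict_of_ae (ae_exists_notMem_overlapSet hn hη hF hs)] with x hx hM
    rw [abs_of_nonneg (tsum_indicator_one_nonneg _ _),
      abs_of_nonneg (tsum_indicator_one_nonneg _ _)]
    exact tsum_indicator_le_tsum_overlapSet hF hx hM

end SparseOverlap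

/-! ### Sparse domination of functions of bounded mean oscillation -/

section SparseDomination

variable {n : ℕ}

lemma MeasureTheory.LocallyIntegrable.integrableOn_cube {f : (Fin n → ℝ) → ℝ}
    (hf : LocallyIntegrable f) (Q : Cube n) : IntegrableOn f Q.toSet :=
  (hf.integrableOn_isCompact (isCompact_closedBall _ _)).mono_set Q.toSet_subset_closedBall

lemma enorm_setAverage_sub_mul_le {f : (Fin n → ℝ) → ℝ} {Q : Cube n}
    (hf : IntegrableOn f Q.toSet) (c : ℝ) :
    ‖(⨍ y in Q.toSet, f y) - c‖ₑ * volume Q.toSet ≤ ∫⁻ y in Q.toSet, ‖f y - c‖ₑ := by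
  have hc : IntegrableOn (fun _ : Fin n → ℝ => c) Q.toSet :=
    integrableOn_const Q.volume_toSet_ne_top
  have h1 : volume.real Q.toSet * ((⨍ y in Q.toSet, f y) - c) = ∫ y in Q.toSet, (f y - c) := by
    rw [integral_sub hf hc, setIntegral_const, setAverage_eq, smul_eq_mul, smul_eq_mul, mul_sub,
      mul_inv_cancel_left₀ Q.volume_real_toSet_pos.ne']
  have h2 : ‖volume.real Q.toSet * ((⨍ y in Q.toSet, f y) - c)‖ₑ =
      ‖(⨍ y in Q.toSet, f y) - c‖ₑ * volume Q.toSet := by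
    rw [enorm_mul, Real.enorm_of_nonneg Q.volume_real_toSet_pos.le, mul_comm, Measure.real,
      ENNReal.ofReal_toReal Q.volume_toSet_ne_top]
  rw [← h2, h1]
  exact enorm_integral_le_lintegral_enorm _

lemma lintegral_enorm_sub_average_le (f : (Fin n → ℝ) → ℝ) (Q : Cube n) :
    ∫⁻ y in Q.toSet, ‖f y - ⨍ z in Q.toSet, f z‖ₑ ≤ bmoNorm f * volume Q.toSet := by
  have h := le_iSup (fun Q : Cube n => (volume Q.toSet)⁻¹ *
    ∫⁻ x in Q.toSet, ‖f x - ⨍ y in Q.toSet, f y‖ₑ) Q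
  calc _ = (volume Q.toSet)⁻¹ * (∫⁻ y in Q.toSet, ‖f y - ⨍ z in Q.toSet, f z‖ₑ) *
        volume Q.toSet := by
        rw [mul_right_comm,
          ENNReal.inv_mul_cancel Q.volume_toSet_ne_zero Q.volume_toSet_ne_top, one_mul]
    _ ≤ _ := mul_le_mul_left h _

open Classical in
/-- The stopping-time ancestor of `Q.path x k`, for the rule that stops at a dyadic cube as soon as
the quantity `m` has moved by more than `A` since the last stop. -/
noncomputable def stopAncestor (m : Cube n → ℝ) (A : ℝ) (Q : Cube n) (x : Fin n → ℝ) : ℕ → Cube n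
  | 0 => Q
  | k + 1 => if A < |m (Q.path x (k + 1)) - m (stopAncestor m A Q x k)| then Q.path x (k + 1)
      else stopAncestor m A Q x k

/-- The family of all cubes at which the stopping rule of `stopAncestor` stops. -/
def stoppingFamily (m : Cube n → ℝ) (A : ℝ) (Q : Cube n) : Set (Cube n) :=
  {P | ∃ x ∈ Q.toSet, ∃ k, P = Q.path x k ∧ stopAncestor m A Q x k = Q.path x k}

variable {m : Cube n → ℝ} {A : ℝ} {Q : Cube n}

lemma stoppingFamily_subset_dyadic : stoppingFamily m A Q ⊆ Q.dyadic := by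
  rintro P ⟨x, _, k, rfl, _⟩
  exact Q.isDyadic_path x k

lemma stopAncestor_congr {x y : Fin n → ℝ} {k : ℕ} (hy : y ∈ (Q.path x k).toSet) :
    stopAncestor m A Q y k = stopAncestor m A Q x k := by
  induction k with
  | zero => rfl
  | succ k ih =>
    rw [stopAncestor, stopAncestor, ih (Cube.child_subset _ _ hy), Cube.path_eq_of_mem hy]

lemma exists_path_of_mem_stoppingFamily {P : Cube n} (hP : P ∈ stoppingFamily m A Q)
    {y : Fin n → ℝ} (hy : y ∈ P.toSet) :
    ∃ k, Q.path y k = P ∧ stopAncestor m A Q y k = P := by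
  obtain ⟨x, _, k, rfl, hk⟩ := hP
  exact ⟨k, Cube.path_eq_of_mem hy, (stopAncestor_congr hy).trans hk⟩

/-- A member of the stopping family strictly inside a member `P` lies in a subcube of `P` at which
`m` differs from `m P` by more than `A`. -/
lemma diff_sparsePart_stoppingFamily_subset {P : Cube n} (hP : P ∈ stoppingFamily m A Q) :
    P.toSet \ sparsePart (stoppingFamily m A Q) P ⊆
      ⋃ R ∈ {R : Cube n | R.toSet ⊆ P.toSet ∧ A < |m R - m P|}, R.toSet := by
  rintro y ⟨hyP, hy⟩
  have hy' : y ∈ ⋃ P' ∈ {P' ∈ stoppingFamily m A Q | P'.toSet ⊂ P.toSet}, P'.toSet := by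
    by_contra h
    exact hy ⟨hyP, h⟩
  simp only [mem_iUnion, exists_prop] at hy'
  obtain ⟨P', ⟨hP', hss⟩, hyP'⟩ := hy'
  obtain ⟨k, hk, hak⟩ := exists_path_of_mem_stoppingFamily hP hyP
  obtain ⟨j, hj, haj⟩ := exists_path_of_mem_stoppingFamily hP' hyP'
  have hQ : y ∈ Q.toSet := Cube.dyadic_subset (stoppingFamily_subset_dyadic hP) hyP
  by_contra hcon
  simp only [mem_iUnion, exists_prop, mem_ofPred_eq, not_exists, not_and] at hcon
  -- Without such a subcube the stopping-time ancestor would remain `P` for ever.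
  have hanc : ∀ i, k ≤ i → stopAncestor m A Q y i = P := by
    intro i hi
    induction i, hi using Nat.le_induction with
    | base => exact hak
    | succ i hi ih =>
      rw [stopAncestor, ih, if_neg]
      intro hlt
      refine hcon (Q.path y (i + 1)) ⟨?_, hlt⟩ (Cube.mem_path hQ _)
      rw [← hk]
      exact Q.path_antitone y (by omega)
  rcases le_total k j with h | h
  · rw [← hanc j h, haj] at hss
    exact ssubset_irrefl _ hss
  · have := Q.path_antitone y h
    simp only [hj, hk] at this
    exact hss.2 this

lemma abs_sub_stopAncestor_le (hA : 0 ≤ A) (x : Fin n → ℝ) (k : ℕ) :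
    |m (Q.path x k) - m (stopAncestor m A Q x k)| ≤ A := by
  cases k with
  | zero => simpa [stopAncestor, Cube.path] using hA
  | succ k =>
    rw [stopAncestor]
    split_ifs with h
    · simpa using hA
    · exact not_lt.1 h

lemma abs_stopAncestor_sub_le (hA : 0 ≤ A) {D : ℝ} (hD : 0 ≤ D) {x : Fin n → ℝ}
    (hx : x ∈ Q.toSet) (hm : ∀ k, |m (Q.path x (k + 1)) - m (Q.path x k)| ≤ D) (k : ℕ) :
    |m (stopAncestor m A Q x k) - m Q| ≤
      (A + D) * overlapCount (stoppingFamily m A Q) Q x (k + 1) := by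
  induction k with
  | zero => simpa [stopAncestor] using by positivity
  | succ k ih =>
    by_cases h : A < |m (Q.path x (k + 1)) - m (stopAncestor m A Q x k)|
    · have hs : stopAncestor m A Q x (k + 1) = Q.path x (k + 1) := by
        rw [stopAncestor, if_pos h]
      rw [overlapCount_succ_of_mem (show Q.path x (k + 1) ∈ stoppingFamily m A Q from
        ⟨x, hx, k + 1, rfl, hs⟩), hs]
      push_cast
      have h1 := abs_sub_stopAncestor_le (m := m) (Q := Q) hA x k
      calc |m (Q.path x (k + 1)) - m Q|
          = |(m (Q.path x (k + 1)) - m (Q.path x k)) +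
              (m (Q.path x k) - m (stopAncestor m A Q x k)) +
              (m (stopAncestor m A Q x k) - m Q)| := by ring_nf
        _ ≤ |m (Q.path x (k + 1)) - m (Q.path x k)| +
              |m (Q.path x k) - m (stopAncestor m A Q x k)| +
              |m (stopAncestor m A Q x k) - m Q| := abs_add_three _ _ _
        _ ≤ _ := by linarith [hm k]
    · rw [stopAncestor, if_neg h]
      refine ih.trans ?_
      gcongr
      exact overlapCount_mono x (Nat.le_succ _)

lemma abs_path_sub_le (hA : 0 ≤ A) {D : ℝ} (hD : 0 ≤ D) {x : Fin n → ℝ}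
    (hx : x ∈ Q.toSet) (hm : ∀ k, |m (Q.path x (k + 1)) - m (Q.path x k)| ≤ D) (k : ℕ) :
    |m (Q.path x k) - m Q| ≤
      (2 * A + D) * overlapCount (stoppingFamily m A Q) Q x (k + 1) := by
  have h1 : 1 ≤ overlapCount (stoppingFamily m A Q) Q x (k + 1) := by
    refine le_trans ?_ (overlapCount_mono x (Nat.succ_le_succ (Nat.zero_le k)))
    rw [overlapCount_succ_of_mem (show Q.path x 0 ∈ stoppingFamily m A Q from ⟨x, hx, 0, rfl, rfl⟩)]
    exact Nat.le_add_left _ _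
  have h1' : (1 : ℝ) ≤ overlapCount (stoppingFamily m A Q) Q x (k + 1) := by exact_mod_cast h1
  have h2 := abs_sub_stopAncestor_le (m := m) (Q := Q) hA x k
  have h3 := abs_stopAncestor_sub_le hA hD hx hm k
  have h4 := abs_sub_le (m (Q.path x k)) (m (stopAncestor m A Q x k)) (m Q)
  nlinarith

lemma overlapCount_le_tsum {F : Set (Cube n)} (hF : F ⊆ Q.dyadic) {x : Fin n → ℝ}
    (hx : x ∈ Q.toSet) (hM : ∃ M, x ∉ overlapSet F Q M) (k : ℕ) :
    (overlapCount F Q x k : ℝ) ≤ ∑' P : F, P.1.toSet.indicator (fun _ => (1 : ℝ)) x := by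
  classical
  obtain ⟨M, hM⟩ := hM
  have hfin : {j | Q.path x j ∈ F}.Finite := by
    by_contra hinf
    refine hM ⟨hx, Nat.nth (fun j => Q.path x j ∈ F) (M + 1), ?_⟩
    rw [overlapCount, Nat.count_nth_of_infinite hinf]
    exact Nat.lt_succ_self M
  have hsum : Summable fun P : F => P.1.toSet.indicator (fun _ => (1 : ℝ)) x := by
    refine summable_of_hasFiniteSupport (((hfin.image (Q.path x)).preimage
      Subtype.val_injective.injOn).subset fun P hP => ?_)
    have hxP : x ∈ P.1.toSet := by
      by_contra h
      exact hP (indicator_of_notMem h _)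
    obtain ⟨j, hj⟩ := Cube.exists_eq_path (hF P.2) hxP
    exact ⟨j, by rw [mem_ofPred_eq, ← hj]; exact P.2, hj.symm⟩
  let S := (Finset.range k).filter fun j => Q.path x j ∈ F
  let g : S → F := fun j => ⟨Q.path x j, (Finset.mem_filter.1 j.2).2⟩
  have hg : Function.Injective g := fun i j h =>
    Subtype.ext (Q.path_injective x (congrArg Subtype.val h))
  calc (overlapCount F Q x k : ℝ)
      = ∑ P ∈ S.attach.image g, P.1.toSet.indicator (fun _ => (1 : ℝ)) x := by
        rw [Finset.sum_image hg.injOn, Finset.sum_congr rfl fun j _ =>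
          indicator_of_mem (Cube.mem_path hx _) _, overlapCount, Nat.count_eq_card_filter_range]
        simp [S]
    _ ≤ _ := hsum.sum_le_tsum _ fun P _ => indicator_nonneg (fun _ _ => zero_le_one) _

/-- Lebesgue's differentiation theorem along dyadic cubes. -/
lemma ae_tendsto_average_path {f : (Fin n → ℝ) → ℝ} (hf : LocallyIntegrable f) (Q : Cube n) :
    ∀ᵐ x, x ∈ Q.toSet →
      Tendsto (fun k => ⨍ y in (Q.path x k).toSet, f y) atTop (𝓝 (f x)) := by
  filter_upwards [IsUnifLocDoublingMeasure.ae_tendsto_average volume hf 1] with x hx hxQ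
  have hδ : Tendsto (fun k => (Q.path x k).side / 2) atTop (𝓝[>] 0) := by
    refine tendsto_nhdsWithin_iff.2 ⟨?_, Eventually.of_forall fun k =>
      half_pos (Q.path x k).side_pos⟩
    have h := (tendsto_pow_atTop_nhds_zero_of_lt_one (by norm_num : (0 : ℝ) ≤ 1 / 2)
      (by norm_num)).const_mul (Q.side / 2)
    rw [mul_zero] at h
    refine h.congr fun k => ?_
    rw [Cube.side_path, div_pow, one_pow]
    ring
  refine (hx (fun k => (Q.path x k).center) _ hδ (Eventually.of_forall fun k => ?_)).congr
    fun k => ?_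
  · rw [one_mul]
    exact Cube.toSet_subset_closedBall _ (Cube.mem_path hxQ k)
  · exact (setAverage_congr (Cube.toSet_ae_eq_closedBall _)).symm

/-- The cubes at which the averages of `f` differ from `⟨f⟩_P` by more than `A` are cubes on which
`|f - ⟨f⟩_P|` has average more than `A`; by the covering estimate they fill at most the part
`5 ^ n * b / A = 1 - η` of `P`. -/
lemma isSparse_stoppingFamily (hn : 0 < n) {η : ℝ} (hη : η < 1) {f : (Fin n → ℝ) → ℝ}
    (hf : LocallyIntegrable f) {b : ℝ} (hb : 0 < b) (hfb : bmoNorm f ≤ ENNReal.ofReal b)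
    (Q : Cube n) :
    IsSparse η (stoppingFamily (fun P => ⨍ y in P.toSet, f y) (5 ^ n * b / (1 - η)) Q) := by
  intro P hP
  have hη' : 0 < 1 - η := by linarith
  set m : Cube n → ℝ := fun P => ⨍ y in P.toSet, f y with hm
  set A : ℝ := 5 ^ n * b / (1 - η) with hA
  have hA0 : 0 < A := by positivity
  set F := stoppingFamily m A Q
  set t := {R : Cube n | R.toSet ⊆ P.toSet ∧ A < |m R - m P|} with ht
  have hcov := volume_biUnion_closedBall_le hn t Cube.center (fun R => R.side / 2)
    (fun R _ => half_pos R.side_pos) (P.toSet.indicator fun y => ‖f y - m P‖ₑ) (ENNReal.ofReal A)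
    (by simpa using hA0) ?_
  · rw [lintegral_indicator P.measurableSet_toSet] at hcov
    have h1 : ENNReal.ofReal A * volume (P.toSet \ sparsePart F P) ≤
        ENNReal.ofReal (5 ^ n * b) * volume P.toSet := by
      calc _ ≤ ENNReal.ofReal A *
            volume (⋃ R ∈ t, Metric.closedBall R.center (R.side / 2)) := by
            refine mul_le_mul_right (measure_mono
              ((diff_sparsePart_stoppingFamily_subset hP).trans ?_)) _
            exact iUnion₂_mono fun R _ => R.toSet_subset_closedBall
        _ ≤ _ := hcov
        _ ≤ 5 ^ n * (ENNReal.ofReal b * volume P.toSet) :=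
            mul_le_mul_right ((lintegral_enorm_sub_average_le f P).trans
              (mul_le_mul_left hfb _)) _
        _ = _ := by
            rw [ENNReal.ofReal_mul (by positivity), ENNReal.ofReal_pow (by norm_num), ← mul_assoc]
            simp
    have h2 := ENNReal.toReal_mono
      (ENNReal.mul_ne_top ENNReal.ofReal_ne_top P.volume_toSet_ne_top) h1
    rw [ENNReal.toReal_mul, ENNReal.toReal_mul, ENNReal.toReal_ofReal hA0.le,
      ENNReal.toReal_ofReal (by positivity)] at h2
    change A * volume.real _ ≤ _ * volume.real _ at h2
    rw [measureReal_sdiff (sparsePart_subset P)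
      (measurableSet_sparsePart stoppingFamily_subset_dyadic P) P.volume_toSet_ne_top,
      show 5 ^ n * b = A * (1 - η) by rw [hA]; field_simp, mul_assoc] at h2
    have h3 := le_of_mul_le_mul_left h2 hA0
    linarith
  · rintro R ⟨hRP, hR⟩
    rw [R.volume_closedBall_center]
    calc ENNReal.ofReal A * volume R.toSet
        ≤ ‖m R - m P‖ₑ * volume R.toSet := by
          rw [Real.enorm_eq_ofReal_abs]
          exact mul_le_mul_left (ENNReal.ofReal_le_ofReal hR.le) _
      _ ≤ ∫⁻ y in R.toSet, ‖f y - m P‖ₑ := enorm_setAverage_sub_mul_le (hf.integrableOn_cube R) _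
      _ = ∫⁻ y in R.toSet, P.toSet.indicator (fun y => ‖f y - m P‖ₑ) y :=
          setLIntegral_congr_fun R.measurableSet_toSet fun y hy =>
            (indicator_of_mem (hRP hy) (fun y => ‖f y - m P‖ₑ)).symm
      _ ≤ _ := lintegral_mono_set R.toSet_subset_closedBall

lemma abs_average_path_succ_sub_le {f : (Fin n → ℝ) → ℝ}
    (hf : LocallyIntegrable f) {b : ℝ} (hb : 0 ≤ b) (hfb : bmoNorm f ≤ ENNReal.ofReal b)
    (Q : Cube n) (x : Fin n → ℝ) (k : ℕ) :
    |(⨍ y in (Q.path x (k + 1)).toSet, f y) - ⨍ y in (Q.path x k).toSet, f y| ≤ 2 ^ n * b := by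
  set R := Q.path x (k + 1)
  set P := Q.path x k
  have h1 : ‖(⨍ y in R.toSet, f y) - ⨍ y in P.toSet, f y‖ₑ * volume R.toSet ≤
      ENNReal.ofReal b * volume P.toSet :=
    (enorm_setAverage_sub_mul_le (hf.integrableOn_cube R) _).trans <|
      (lintegral_mono_set (Q.path_antitone x (Nat.le_succ k))).trans <|
      (lintegral_enorm_sub_average_le f P).trans (mul_le_mul_left hfb _)
  have h2 := ENNReal.toReal_mono (ENNReal.mul_ne_top (by simp) P.volume_toSet_ne_top) h1
  rw [ENNReal.toReal_mul, ENNReal.toReal_mul, toReal_enorm, Real.norm_eq_abs,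
    ENNReal.toReal_ofReal hb] at h2
  change _ * volume.real _ ≤ _ * volume.real _ at h2
  rw [show volume.real P.toSet = 2 ^ n * volume.real R.toSet from Q.volume_real_path x k,
    ← mul_assoc] at h2
  linarith [le_of_mul_le_mul_right h2 R.volume_real_toSet_pos]

/-- Sparse domination: the oscillation of `f` on `Q` is pointwise controlled by the overlap of the
stopping family of `f`. -/
lemma ae_abs_sub_average_le_tsum (hn : 0 < n) {η : ℝ} (hη : η ∈ Ioo (0 : ℝ) 1)
    {f : (Fin n → ℝ) → ℝ} (hf : LocallyIntegrable f) {b : ℝ} (hb : 0 < b)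
    (hfb : bmoNorm f ≤ ENNReal.ofReal b) (Q : Cube n) :
    ∀ᵐ x ∂volume.restrict Q.toSet, |f x - ⨍ y in Q.toSet, f y| ≤
      (2 * 5 ^ n / (1 - η) + 2 ^ n) * b *
        ∑' P : stoppingFamily (fun P => ⨍ y in P.toSet, f y) (5 ^ n * b / (1 - η)) Q,
          P.1.toSet.indicator (fun _ => (1 : ℝ)) x := by
  have hη' : 0 < 1 - η := by linarith [hη.2]
  filter_upwards [ae_restrict_mem Q.measurableSet_toSet,
    ae_restrict_of_ae (ae_tendsto_average_path hf Q),
    ae_restrict_of_ae (ae_exists_notMem_overlapSet hn hη stoppingFamily_subset_dyadic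
      (isSparse_stoppingFamily hn hη.2 hf hb hfb Q))] with x hx hlim hM
  refine le_of_tendsto ((hlim hx).sub_const _).abs (Eventually.of_forall fun k => ?_)
  refine (abs_path_sub_le (m := fun P => ⨍ y in P.toSet, f y) (A := 5 ^ n * b / (1 - η))
    (by positivity) (by positivity) hx (abs_average_path_succ_sub_le hf hb.le hfb Q x) k).trans ?_
  rw [show 2 * (5 ^ n * b / (1 - η)) + 2 ^ n * b = (2 * 5 ^ n / (1 - η) + 2 ^ n) * b by ring]
  exact mul_le_mul_of_nonneg_left (overlapCount_le_tsum stoppingFamily_subset_dyadic hx hM _)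
    (by positivity)

lemma BMOEmbedding.of_sparseBound (hn : 0 < n) {η : ℝ} (hη : η ∈ Ioo (0 : ℝ) 1)
    {X : FunctionSpaceFamily n} {C : ℝ≥0} (h : SparseBound η X C) :
    BMOEmbedding X (Real.toNNReal (2 * 5 ^ n / (1 - η) + 2 ^ n) * C) := by
  intro f hf hfin
  have hη' : 0 < 1 - η := by linarith [hη.2]
  -- An arbitrary `c > ‖f‖_BMO` is used, since the stopping argument needs a positive bound.
  refine iSup_le fun Q => ENNReal.le_mul_of_forall_lt (Or.inr hfin.ne)
    (Or.inl ENNReal.coe_ne_top) fun a ha c hc => ?_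
  rcases eq_or_ne c ∞ with rfl | hctop
  · rw [ENNReal.mul_top (zero_le.trans_lt ha).ne']
    exact le_top
  have hc0 : 0 < c.toReal := ENNReal.toReal_pos (zero_le.trans_lt hc).ne' hctop
  have hfb : bmoNorm f ≤ ENNReal.ofReal c.toReal := by
    rw [ENNReal.ofReal_toReal hctop]
    exact hc.le
  have hmeas : AEMeasurable (fun x => f x - ⨍ y in Q.toSet, f y) (volume.restrict Q.toSet) :=
    ((hf.integrableOn_cube Q).aestronglyMeasurable.aemeasurable).sub_const _
  refine ((X Q).nrm_le_of_abs_le hmeas (c := (2 * 5 ^ n / (1 - η) + 2 ^ n) * c.toReal)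
    (by positivity) ?_).trans ((mul_le_mul_right (h Q _ stoppingFamily_subset_dyadic
      (isSparse_stoppingFamily hn hη.2 hf hc0 hfb Q)) _).trans ?_)
  · filter_upwards [ae_abs_sub_average_le_tsum hn hη hf hc0 hfb Q] with x hx
    rwa [abs_of_nonneg (tsum_indicator_one_nonneg _ _)]
  · rw [ENNReal.ofReal_mul (by positivity), ENNReal.ofReal_toReal hctop, mul_right_comm]
    refine mul_le_mul_left (le_trans (le_of_eq ?_) ha.le) _
    rw [ENNReal.coe_mul, ENNReal.ofNNReal_toNNReal]

end SparseDomination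

/-! ### The maximal function -/

section Maximal

variable {n : ℕ}

/-- The uncentred Hardy–Littlewood maximal function with respect to open balls of the sup metric,
that is, open cubes. Balls of radius `r ≤ 0` are empty and contribute `0`. -/
noncomputable def maximalFn (G : (Fin n → ℝ) → ℝ≥0∞) (x : Fin n → ℝ) : ℝ≥0∞ :=
  ⨆ (c : Fin n → ℝ) (r : ℝ), (Metric.ball c r).indicator
    (fun _ => (volume (Metric.ball c r))⁻¹ * ∫⁻ y in Metric.ball c r, G y) x

lemma measurable_maximalFn (G : (Fin n → ℝ) → ℝ≥0∞) : Measurable (maximalFn G) :=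
  LowerSemicontinuous.measurable <| lowerSemicontinuous_iSup fun _ =>
    lowerSemicontinuous_iSup fun _ => Metric.isOpen_ball.lowerSemicontinuous_indicator zero_le

lemma volume_ball_ne_zero (c : Fin n → ℝ) {r : ℝ} (hr : 0 < r) :
    volume (Metric.ball c r) ≠ 0 := (Metric.measure_ball_pos volume c hr).ne'

lemma volume_ball_ne_top (c : Fin n → ℝ) (r : ℝ) : volume (Metric.ball c r) ≠ ∞ :=
  measure_ball_lt_top.ne

lemma lintegral_ball_le_mul_maximalFn (G : (Fin n → ℝ) → ℝ≥0∞) {c x : Fin n → ℝ} {r : ℝ}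
    (hx : x ∈ Metric.ball c r) :
    ∫⁻ y in Metric.ball c r, G y ≤ volume (Metric.ball c r) * maximalFn G x := by
  have hr : 0 < r := dist_nonneg.trans_lt hx
  have h : (volume (Metric.ball c r))⁻¹ * ∫⁻ y in Metric.ball c r, G y ≤ maximalFn G x := by
    refine le_iSup₂_of_le c r ?_
    rw [indicator_of_mem hx]
  rwa [ENNReal.inv_mul_le_iff (volume_ball_ne_zero c hr) (volume_ball_ne_top c r)] at h

lemma exists_ball_of_lt_maximalFn {G : (Fin n → ℝ) → ℝ≥0∞} {x : Fin n → ℝ} {lam : ℝ≥0∞}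
    (h : lam < maximalFn G x) : ∃ c r, x ∈ Metric.ball c r ∧
      lam * volume (Metric.ball c r) < ∫⁻ y in Metric.ball c r, G y := by
  simp only [maximalFn, lt_iSup_iff] at h
  obtain ⟨c, r, h⟩ := h
  by_cases hx : x ∈ Metric.ball c r
  · refine ⟨c, r, hx, ?_⟩
    have hr : 0 < r := dist_nonneg.trans_lt hx
    rw [indicator_of_mem hx, mul_comm, ← div_eq_mul_inv,
      ENNReal.lt_div_iff_mul_lt (Or.inl (volume_ball_ne_zero c hr))
        (Or.inl (volume_ball_ne_top c r))] at h
    exact h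
  · simp [hx] at h

lemma ball_ae_eq_closedBall_pi (c : Fin n → ℝ) {r : ℝ} (hr : 0 < r) :
    Metric.ball c r =ᵐ[volume] Metric.closedBall c r :=
  ae_eq_of_subset_of_measure_ge Metric.ball_subset_closedBall
    (by rw [Real.volume_pi_ball c hr, Real.volume_pi_closedBall c hr.le])
    Metric.isOpen_ball.measurableSet.nullMeasurableSet measure_closedBall_lt_top.ne

/-- The form of the covering estimate needed for the maximal function, localized to a set `S`. -/
lemma volume_iUnion_ball_le (hn : 0 < n) (G : (Fin n → ℝ) → ℝ≥0∞) {S : Set (Fin n → ℝ)}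
    (hS : MeasurableSet S) {lam : ℝ≥0∞} (hlam : lam ≠ 0) :
    lam * volume {x | ∃ c r, x ∈ Metric.ball c r ∧ Metric.ball c r ⊆ S ∧
      lam * volume (Metric.ball c r) < ∫⁻ y in Metric.ball c r, G y} ≤
      5 ^ n * ∫⁻ y in S, G y := by
  rw [← lintegral_indicator hS]
  let t : Set ((Fin n → ℝ) × ℝ) := {p | 0 < p.2 ∧ Metric.ball p.1 p.2 ⊆ S ∧
      lam * volume (Metric.ball p.1 p.2) < ∫⁻ y in Metric.ball p.1 p.2, G y}
  refine le_trans (mul_le_mul_right (measure_mono ?_) _)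
    (volume_biUnion_closedBall_le hn t Prod.fst Prod.snd (fun a ha => ha.1)
      (S.indicator G) lam hlam ?_)
  · rintro x ⟨c, r, hx, hcS, h⟩
    exact mem_biUnion (show (c, r) ∈ t from ⟨dist_nonneg.trans_lt hx, hcS, h⟩)
      (Metric.ball_subset_closedBall hx)
  · rintro ⟨c, r⟩ ⟨hr, hcS, h⟩
    rw [← measure_congr (ball_ae_eq_closedBall_pi c hr),
      ← setLIntegral_congr (ball_ae_eq_closedBall_pi c hr)]
    refine h.le.trans (le_of_eq ?_)
    exact setLIntegral_congr_fun Metric.isOpen_ball.measurableSet fun y hy =>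
      (indicator_of_mem (hcS hy) G).symm

/-- The weak type `(1, 1)` estimate for the maximal function. -/
lemma volume_lt_maximalFn_le (hn : 0 < n) (G : (Fin n → ℝ) → ℝ≥0∞) {lam : ℝ≥0∞}
    (hlam : lam ≠ 0) : lam * volume {x | lam < maximalFn G x} ≤ 5 ^ n * ∫⁻ y, G y := by
  have h := volume_iUnion_ball_le hn G MeasurableSet.univ hlam
  rw [setLIntegral_univ] at h
  refine (mul_le_mul_right (measure_mono fun x hx => ?_) _).trans h
  obtain ⟨c, r, hxc, hlt⟩ := exists_ball_of_lt_maximalFn hx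
  exact ⟨c, r, hxc, subset_univ _, hlt⟩

lemma ae_maximalFn_lt_top (hn : 0 < n) {G : (Fin n → ℝ) → ℝ≥0∞} (hG : ∫⁻ y, G y ≠ ∞) :
    ∀ᵐ x, maximalFn G x < ∞ := by
  rw [ae_iff]
  by_contra hne
  have hI : 5 ^ n * ∫⁻ y, G y ≠ ∞ := ENNReal.mul_ne_top (by simp) hG
  have hbound : ∀ k : ℕ, (k : ℝ≥0∞) * volume {x | ¬ maximalFn G x < ∞} ≤ 5 ^ n * ∫⁻ y, G y := by
    intro k
    rcases Nat.eq_zero_or_pos k with rfl | hk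
    · simp
    refine (mul_le_mul_right (measure_mono fun x hx => ?_) _).trans
      (volume_lt_maximalFn_le hn G (by exact_mod_cast hk.ne' : (k : ℝ≥0∞) ≠ 0))
    have hx' : maximalFn G x = ∞ := not_lt_top_iff.1 hx
    rw [mem_ofPred_eq, hx']
    exact ENNReal.natCast_lt_top k
  obtain ⟨k, hk⟩ := ENNReal.exists_nat_mul_gt hne hI
  exact absurd (hbound k) (not_le.2 hk)

lemma ae_le_maximalFn {G : (Fin n → ℝ) → ℝ≥0∞} (hGm : Measurable G) (hG : ∫⁻ y, G y ≠ ∞) :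
    ∀ᵐ x, G x ≤ maximalFn G x := by
  filter_upwards [(IsUnifLocDoublingMeasure.vitaliFamily volume 1).ae_tendsto_lintegral_div
    hGm.aemeasurable hG] with x hx
  have hδ : Tendsto (fun k : ℕ => 1 / ((k : ℝ) + 1)) atTop (𝓝[>] 0) :=
    tendsto_nhdsWithin_iff.2 ⟨tendsto_one_div_add_atTop_nhds_zero_nat,
      Eventually.of_forall fun k => mem_Ioi.2 Nat.one_div_pos_of_nat⟩
  have hlim := hx.comp (IsUnifLocDoublingMeasure.tendsto_closedBall_filterAt volume
    (fun _ : ℕ => x) _ hδ (Eventually.of_forall fun k =>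
      Metric.mem_closedBall_self (by rw [one_mul]; exact (Nat.one_div_pos_of_nat).le)))
  refine le_of_tendsto hlim (Eventually.of_forall fun k => ?_)
  have hr : 0 < 1 / ((k : ℝ) + 1) := Nat.one_div_pos_of_nat
  simp only [Function.comp_apply]
  rw [← measure_congr (ball_ae_eq_closedBall_pi x hr),
      ← setLIntegral_congr (ball_ae_eq_closedBall_pi x hr)]
  refine ENNReal.div_le_of_le_mul' ?_
  exact lintegral_ball_le_mul_maximalFn G (Metric.mem_ball_self hr)

lemma Cube.dist_lt_side {P : Cube n} {x y : Fin n → ℝ} (hx : x ∈ P.toSet) (hy : y ∈ P.toSet) :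
    dist x y < P.side := by
  rw [dist_pi_lt_iff P.side_pos]
  intro i
  have h1 := Cube.mem_toSet.1 hx i
  have h2 := Cube.mem_toSet.1 hy i
  rw [Real.dist_eq, abs_lt]
  constructor <;> linarith

lemma volume_ball_mul_three (c : Fin n → ℝ) {r : ℝ} (hr : 0 < r) :
    volume (Metric.ball c (3 * r)) = 3 ^ n * volume (Metric.ball c r) := by
  rw [Real.volume_pi_ball c hr, Real.volume_pi_ball c (by positivity), Fintype.card_fin,
    show 2 * (3 * r) = 3 * (2 * r) by ring, mul_pow, ENNReal.ofReal_mul (by positivity),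
    ENNReal.ofReal_pow (by norm_num)]
  simp

/-- The maximal function is comparable to its infimum on a cube `P`, in the weak `L¹` sense: the
contribution of large balls is essentially constant on `P`, and for the small ones the weak type
`(1, 1)` estimate applies to the restriction of `G` to the tripled cube. -/
lemma volume_lt_maximalFn_inter_le (hn : 0 < n) (G : (Fin n → ℝ) → ℝ≥0∞) (P : Cube n)
    {lam : ℝ≥0∞} (hlam : lam ≠ 0) :
    lam * volume {x | x ∈ P.toSet ∧ lam < maximalFn G x} ≤
      15 ^ n * (⨅ y ∈ P.toSet, maximalFn G y) * volume P.toSet := by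
  set m := ⨅ y ∈ P.toSet, maximalFn G y with hm
  have h15 : (15 : ℝ≥0∞) ^ n = 5 ^ n * 3 ^ n := by rw [← mul_pow]; norm_num
  rcases lt_or_ge lam (3 ^ n * m) with hlt | hge
  · refine mul_le_mul' (hlt.le.trans ?_) (measure_mono fun x hx => hx.1)
    gcongr
    norm_num
  set B := Metric.ball P.center (3 * (P.side / 2)) with hB
  have hside := P.side_pos
  have hcen : ∀ x ∈ P.toSet, dist x P.center ≤ P.side / 2 := fun x hx =>
    Metric.mem_closedBall.1 (P.toSet_subset_closedBall hx)
  have hBm : ∫⁻ y in B, G y ≤ 3 ^ n * volume P.toSet * m := by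
    have hv : volume B = 3 ^ n * volume P.toSet := by
      rw [hB, volume_ball_mul_three _ (half_pos hside),
        measure_congr (ball_ae_eq_closedBall_pi _ (half_pos hside)), P.volume_closedBall_center]
    rw [← hv, hm, ENNReal.mul_iInf_of_ne (volume_ball_ne_zero _ (by positivity))
      (volume_ball_ne_top _ _)]
    refine le_iInf fun y => ?_
    rw [ENNReal.mul_iInf_of_ne (volume_ball_ne_zero _ (by positivity)) (volume_ball_ne_top _ _)]
    refine le_iInf fun hy => lintegral_ball_le_mul_maximalFn G ?_
    rw [Metric.mem_ball]
    linarith [hcen y hy]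
  calc lam * volume {x | x ∈ P.toSet ∧ lam < maximalFn G x}
      ≤ lam * volume {x | ∃ c r, x ∈ Metric.ball c r ∧ Metric.ball c r ⊆ B ∧
          lam * volume (Metric.ball c r) < ∫⁻ y in Metric.ball c r, G y} := by
        refine mul_le_mul_right (measure_mono fun x hx => ?_) _
        obtain ⟨hxP, hlt⟩ := hx
        obtain ⟨c, r, hxc, h⟩ := exists_ball_of_lt_maximalFn hlt
        refine ⟨c, r, hxc, ?_, h⟩
        have hr : 0 < r := dist_nonneg.trans_lt hxc
        have hsmall : 2 * r < P.side := by
          by_contra! hbig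
          -- A large ball, tripled, covers `P`, which makes `maximalFn G` too large on all of `P`.
          have hle : ∫⁻ y in Metric.ball c r, G y ≤ volume (Metric.ball c (3 * r)) * m := by
            rw [hm, ENNReal.mul_iInf_of_ne (volume_ball_ne_zero _ (by positivity))
              (volume_ball_ne_top _ _)]
            refine le_iInf fun y => ?_
            rw [ENNReal.mul_iInf_of_ne (volume_ball_ne_zero _ (by positivity))
              (volume_ball_ne_top _ _)]
            refine le_iInf fun hy => ?_
            refine (lintegral_mono_set (Metric.ball_subset_ball (by linarith))).trans
              (lintegral_ball_le_mul_maximalFn G ?_)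
            rw [Metric.mem_ball] at hxc ⊢
            linarith [dist_triangle y x c, Cube.dist_lt_side hy hxP]
          rw [volume_ball_mul_three c hr, mul_right_comm] at hle
          exact absurd (h.trans_le hle) (not_lt.2 (mul_le_mul_left hge _))
        intro z hz
        rw [Metric.mem_ball] at hz hxc
        rw [hB, Metric.mem_ball]
        linarith [dist_triangle z c P.center, dist_triangle_left c P.center x, hcen x hxP]
    _ ≤ 5 ^ n * ∫⁻ y in B, G y :=
        volume_iUnion_ball_le hn G Metric.isOpen_ball.measurableSet hlam
    _ ≤ 5 ^ n * (3 ^ n * volume P.toSet * m) := mul_le_mul_right hBm _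
    _ = _ := by rw [h15]; ring

end Maximal

/-! ### The logarithm of the maximal function -/

section LogMaximal

variable {n : ℕ}

/-- Discrete layer-cake estimate. -/
lemma lintegral_ofReal_le_of_forall_volume_le {φ : (Fin n → ℝ) → ℝ} (hφ : Measurable φ)
    {S : Set (Fin n → ℝ)} {K : ℝ≥0∞}
    (h : ∀ k : ℕ, volume {x | x ∈ S ∧ (k : ℝ) < φ x} ≤ K * 2⁻¹ ^ k) :
    ∫⁻ x in S, ENNReal.ofReal (φ x) ≤ 2 * K := by
  have hm : ∀ k : ℕ, MeasurableSet {x | (k : ℝ) < φ x} := fun k =>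
    measurableSet_lt measurable_const hφ
  calc ∫⁻ x in S, ENNReal.ofReal (φ x)
      ≤ ∫⁻ x in S, ∑' k : ℕ, {x | (k : ℝ) < φ x}.indicator (fun _ => (1 : ℝ≥0∞)) x := by
        refine lintegral_mono fun x => ?_
        calc ENNReal.ofReal (φ x) ≤ (⌈φ x⌉₊ : ℝ≥0∞) := by
              rw [← ENNReal.ofReal_natCast]
              exact ENNReal.ofReal_le_ofReal (Nat.le_ceil _)
          _ = ∑ k ∈ Finset.range ⌈φ x⌉₊,
              {x | (k : ℝ) < φ x}.indicator (fun _ => (1 : ℝ≥0∞)) x := by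
              have hk : ∀ k ∈ Finset.range ⌈φ x⌉₊,
                  {x | (k : ℝ) < φ x}.indicator (fun _ => (1 : ℝ≥0∞)) x = 1 := fun k hk =>
                indicator_of_mem (show x ∈ {x | (k : ℝ) < φ x} from
                  Nat.lt_ceil.1 (Finset.mem_range.1 hk)) _
              rw [Finset.sum_congr rfl hk]
              simp
          _ ≤ _ := ENNReal.sum_le_tsum _
    _ = ∑' k : ℕ, volume {x | x ∈ S ∧ (k : ℝ) < φ x} := by
        rw [lintegral_tsum fun k => (measurable_const.indicator (hm k)).aemeasurable]
        refine tsum_congr fun k => ?_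
        rw [lintegral_indicator_const (hm k), one_mul, Measure.restrict_apply (hm k), inter_comm]
        rfl
    _ ≤ ∑' k : ℕ, K * 2⁻¹ ^ k := ENNReal.tsum_le_tsum h
    _ = 2 * K := by
        rw [ENNReal.tsum_mul_left, ENNReal.tsum_geometric, ENNReal.one_sub_inv_two, inv_inv,
          mul_comm]

/-- The powers of `2` come from the crude bound `2 ^ k ≤ e ^ k`. -/
lemma two_pow_mul_max_lt_of_lt_posLog_sub {τ z a : ℝ} (hτ : 0 < τ) (hz : 0 ≤ z) (ha : 0 ≤ a)
    {k : ℕ} (h : k < Real.posLog (a / τ) - Real.posLog (z / τ)) : 2 ^ k * max τ z < a := by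
  have hz' : 0 ≤ z / τ := by positivity
  have hpos : 0 < Real.posLog (a / τ) := by
    have := Real.posLog_nonneg (x := z / τ)
    have : (0 : ℝ) ≤ k := Nat.cast_nonneg k
    linarith
  have hay : 0 < Real.log (a / τ) := by
    rw [Real.posLog_apply] at hpos
    simpa using hpos
  have ha0 : 0 < a / τ := by
    refine lt_of_le_of_ne (by positivity) fun h0 => ?_
    simp [← h0] at hay
  have h1 : k + Real.posLog (z / τ) < Real.log (a / τ) := by
    rw [Real.posLog_apply (x := a / τ), max_eq_right hay.le] at h
    linarith
  have h2 : Real.exp k * max 1 (z / τ) < a / τ := by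
    rw [← Real.exp_log ha0, ← Real.exp_log (lt_max_of_lt_left one_pos : 0 < max 1 (z / τ)),
      ← Real.exp_add, ← Real.posLog_eq_log_max_one hz']
    exact Real.exp_lt_exp.2 h1
  have h3 : (2 : ℝ) ^ k ≤ Real.exp k := by
    rw [← Real.exp_one_pow]
    exact pow_le_pow_left₀ (by norm_num) (by linarith [Real.add_one_le_exp (1 : ℝ)]) k
  have h4 : max τ z = τ * max 1 (z / τ) := by
    rw [mul_max_of_nonneg _ _ hτ.le, mul_one, mul_div_cancel₀ _ hτ.ne']
  rw [lt_div_iff₀ hτ] at h2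
  rw [h4]
  have : 0 ≤ τ * max 1 (z / τ) := by positivity
  nlinarith

/-- The positive part of `log (M G / τ)`, with `M G` the maximal function of `G`. Where `M G = ∞`,
a null set if `G` is integrable, the value is `0`. -/
noncomputable def logMaximal (G : (Fin n → ℝ) → ℝ≥0∞) (τ : ℝ) (x : Fin n → ℝ) : ℝ :=
  Real.posLog ((maximalFn G x).toReal / τ)

lemma measurable_logMaximal (G : (Fin n → ℝ) → ℝ≥0∞) (τ : ℝ) : Measurable (logMaximal G τ) :=
  Real.continuous_posLog.measurable.comp ((measurable_maximalFn G).ennreal_toReal.div_const τ)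

lemma logMaximal_nonneg (G : (Fin n → ℝ) → ℝ≥0∞) (τ : ℝ) (x : Fin n → ℝ) :
    0 ≤ logMaximal G τ x := Real.posLog_nonneg

lemma ofReal_two_pow_mul_max_lt_maximalFn {G : (Fin n → ℝ) → ℝ≥0∞} {τ z : ℝ} (hτ : 0 < τ)
    (hz : 0 ≤ z) {x : Fin n → ℝ} {k : ℕ}
    (h : k < logMaximal G τ x - Real.posLog (z / τ)) :
    ENNReal.ofReal (2 ^ k * max τ z) < maximalFn G x := by
  have h1 := two_pow_mul_max_lt_of_lt_posLog_sub hτ hz ENNReal.toReal_nonneg h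
  exact (ENNReal.ofReal_lt_iff_lt_toReal (by positivity)
    (ENNReal.toReal_pos_iff.1 (lt_of_le_of_lt (by positivity) h1)).2.ne).2 h1

lemma le_div_mul_inv_two_pow {a : ℝ} (ha : 0 < a) {k : ℕ} {V K : ℝ≥0∞}
    (h : ENNReal.ofReal (2 ^ k * a) * V ≤ K) : V ≤ K / ENNReal.ofReal a * 2⁻¹ ^ k := by
  rw [← ENNReal.inv_pow, div_eq_mul_inv, mul_assoc, ← ENNReal.mul_inv (by simp) (by simp),
    ← div_eq_mul_inv, ENNReal.le_div_iff_mul_le (by simp [ha]) (by simp [ENNReal.mul_eq_top]),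
    mul_comm]
  refine le_trans (le_of_eq ?_) h
  rw [ENNReal.ofReal_mul (by positivity), ENNReal.ofReal_pow (by norm_num), ENNReal.ofReal_ofNat,
    mul_comm (ENNReal.ofReal a)]

/-- The Coifman–Rochberg theorem: the logarithm of a maximal function has bounded mean
oscillation. On a cube `P` the constant is the truncated logarithm of the infimum `m` of the maximal
function over `P`; the set where the logarithm exceeds it by more than `k` has measure `O(2⁻ᵏ |P|)`
by `volume_lt_maximalFn_inter_le`. -/
lemma exists_lintegral_logMaximal_sub_le (hn : 0 < n) {G : (Fin n → ℝ) → ℝ≥0∞}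
    (hG : ∫⁻ y, G y ≠ ∞) {τ : ℝ} (hτ : 0 < τ) (P : Cube n) :
    ∃ c : ℝ, ∫⁻ x in P.toSet, ‖logMaximal G τ x - c‖ₑ ≤ 2 * 15 ^ n * volume P.toSet := by
  set m := ⨅ y ∈ P.toSet, maximalFn G y with hm
  have hmle : ∀ y ∈ P.toSet, m ≤ maximalFn G y := fun y hy => iInf₂_le y hy
  have htop := ae_maximalFn_lt_top hn hG
  have hmtop : m ≠ ∞ := by
    intro h
    refine P.volume_toSet_ne_zero (measure_mono_null (fun y hy => ?_) (ae_iff.1 htop))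
    exact not_lt.2 (h ▸ hmle y hy)
  set c := Real.posLog (m.toReal / τ) with hc
  refine ⟨c, ?_⟩
  have hmax : 0 < max τ m.toReal := lt_max_of_lt_left hτ
  have hmmax : m ≤ ENNReal.ofReal (max τ m.toReal) := by
    conv_lhs => rw [← ENNReal.ofReal_toReal hmtop]
    exact ENNReal.ofReal_le_ofReal (le_max_right _ _)
  calc ∫⁻ x in P.toSet, ‖logMaximal G τ x - c‖ₑ
      = ∫⁻ x in P.toSet, ENNReal.ofReal (logMaximal G τ x - c) := by
        refine lintegral_congr_ae ?_
        filter_upwards [ae_restrict_mem P.measurableSet_toSet, ae_restrict_of_ae htop] with x hx hx'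
        refine Real.enorm_of_nonneg (sub_nonneg.2 (Real.posLog_le_posLog (by positivity) ?_))
        gcongr
        · exact hx'.ne
        · exact hmle x hx
    _ ≤ 2 * (15 ^ n * volume P.toSet) := by
        refine lintegral_ofReal_le_of_forall_volume_le ((measurable_logMaximal G τ).sub_const c)
          fun k => ?_
        have h1 := volume_lt_maximalFn_inter_le hn G P
          (lam := ENNReal.ofReal (2 ^ k * max τ m.toReal)) (by simp [hτ])
        have h2 : volume {x | x ∈ P.toSet ∧ (k : ℝ) < logMaximal G τ x - c} ≤
            volume {x | x ∈ P.toSet ∧ ENNReal.ofReal (2 ^ k * max τ m.toReal) < maximalFn G x} :=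
          measure_mono fun x hx =>
            ⟨hx.1, ofReal_two_pow_mul_max_lt_maximalFn hτ ENNReal.toReal_nonneg hx.2⟩
        refine h2.trans ((le_div_mul_inv_two_pow hmax h1).trans (mul_le_mul_left ?_ _))
        refine ENNReal.div_le_of_le_mul ?_
        rw [mul_right_comm]
        exact mul_le_mul_right hmmax _
    _ = _ := by ring

lemma volume_lt_logMaximal_le (hn : 0 < n) (G : (Fin n → ℝ) → ℝ≥0∞) {τ : ℝ} (hτ : 0 < τ)
    (k : ℕ) : volume {x | (k : ℝ) < logMaximal G τ x} ≤
      5 ^ n * (∫⁻ y, G y) / ENNReal.ofReal τ * 2⁻¹ ^ k := by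
  refine le_div_mul_inv_two_pow hτ (le_trans (mul_le_mul_right (measure_mono fun x hx => ?_) _)
    (volume_lt_maximalFn_le hn G (lam := ENNReal.ofReal (2 ^ k * τ)) (by simp [hτ])))
  have h := ofReal_two_pow_mul_max_lt_maximalFn (G := G) (x := x) (k := k) hτ le_rfl
    (by simpa using hx)
  rwa [max_eq_left hτ.le] at h

end LogMaximal

/-! ### Functions of bounded mean oscillation with prescribed exponential growth -/

section Majorant

variable {n : ℕ}

lemma Cube.exists_toSet_mem_nhds (x : Fin n → ℝ) : ∃ P : Cube n, P.toSet ∈ 𝓝 x := by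
  refine ⟨⟨fun i => x i - 1, 2, two_pos⟩, mem_of_superset (Metric.ball_mem_nhds x one_pos) ?_⟩
  intro y hy
  rw [Metric.mem_ball, dist_pi_lt_iff one_pos] at hy
  refine Cube.mem_toSet.2 fun i => ?_
  have h := abs_lt.1 (Real.dist_eq (y i) (x i) ▸ hy i)
  constructor
  · linarith [h.1]
  · simp only
    linarith [h.2]

lemma locallyIntegrable_of_forall_cube {h : (Fin n → ℝ) → ℝ} (hm : Measurable h) {K : ℝ≥0∞}
    (hK : K ≠ ∞)
    (hosc : ∀ P : Cube n, ∃ c : ℝ, ∫⁻ x in P.toSet, ‖h x - c‖ₑ ≤ K * volume P.toSet) :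
    LocallyIntegrable h := by
  intro x
  obtain ⟨P, hP⟩ := Cube.exists_toSet_mem_nhds x
  refine ⟨P.toSet, hP, ?_⟩
  obtain ⟨c, hc⟩ := hosc P
  have h1 : IntegrableOn (fun x => h x - c) P.toSet :=
    ⟨(hm.sub_const c).aestronglyMeasurable,
      hc.trans_lt (ENNReal.mul_lt_top hK.lt_top P.volume_toSet_ne_top.lt_top)⟩
  refine (h1.add (integrableOn_const P.volume_toSet_ne_top (C := c))).congr
    (Eventually.of_forall fun x => ?_)
  simp

/-- In the definition of `‖h‖_BMO` averages may be replaced by arbitrary constants, at the cost of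
a factor `2`. -/
lemma bmoNorm_le_of_forall_cube {h : (Fin n → ℝ) → ℝ} (hh : LocallyIntegrable h) {K : ℝ≥0∞}
    (hosc : ∀ P : Cube n, ∃ c : ℝ, ∫⁻ x in P.toSet, ‖h x - c‖ₑ ≤ K * volume P.toSet) :
    bmoNorm h ≤ 2 * K := by
  refine iSup_le fun P => ?_
  obtain ⟨c, hc⟩ := hosc P
  rw [ENNReal.inv_mul_le_iff P.volume_toSet_ne_zero P.volume_toSet_ne_top]
  have h1 := enorm_setAverage_sub_mul_le (hh.integrableOn_cube P) c
  calc ∫⁻ x in P.toSet, ‖h x - ⨍ y in P.toSet, h y‖ₑ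
      ≤ ∫⁻ x in P.toSet, (‖h x - c‖ₑ + ‖(⨍ y in P.toSet, h y) - c‖ₑ) := by
        refine lintegral_mono fun x => ?_
        rw [← sub_sub_sub_cancel_right _ _ c]
        exact enorm_sub_le
    _ = (∫⁻ x in P.toSet, ‖h x - c‖ₑ) + ‖(⨍ y in P.toSet, h y) - c‖ₑ * volume P.toSet := by
        rw [lintegral_add_right _ measurable_const, setLIntegral_const]
    _ ≤ K * volume P.toSet + K * volume P.toSet := add_le_add hc (h1.trans hc)
    _ = _ := by ring

lemma Cube.volume_real_child (Q : Cube n) (ε : Fin n → Bool) :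
    volume.real (Q.child ε).toSet = 2⁻¹ ^ n * volume.real Q.toSet := by
  rw [volume_real_toSet, volume_real_toSet, ← mul_pow]
  congr 1
  rw [child]
  ring

/-- For `∫ G ≤ |Q|` there is a function `h` whose `BMO` norm is bounded in terms of `n` and such
that a multiple of `|h - ⟨h⟩_Q|` dominates `log (1 + G)` on `Q`. The function is `h = v + χ_E`, with
`v` the truncated logarithm of the maximal function of `G`. The truncation makes the average of `v`
and the set `{v > 0}` small; `E` is the union of this set and of a child of `Q`, and the average of
`χ_E` over `Q` is far from both `0` and `1`. So `h` stays away from `⟨h⟩_Q` on all of `Q`. -/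
lemma exists_bmo_majorant (hn : 0 < n) (Q : Cube n) {G : (Fin n → ℝ) → ℝ≥0∞}
    (hGm : Measurable G) (hG : ∫⁻ y, G y ≤ volume Q.toSet) :
    ∃ h : (Fin n → ℝ) → ℝ, LocallyIntegrable h ∧ bmoNorm h ≤ 2 * (2 * 15 ^ n + 1) ∧
      ∀ᵐ x ∂volume.restrict Q.toSet, Real.log (1 + (G x).toReal) ≤
        (Real.log (32 * 5 ^ n) + 1) * 2 ^ (n + 1) * |h x - ⨍ y in Q.toSet, h y| := by
  have hGtop : ∫⁻ y, G y ≠ ∞ := ne_top_of_le_ne_top Q.volume_toSet_ne_top hG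
  -- With this truncation level `|{v > 0}| ≤ |Q| / 16` and `∫_Q v ≤ |Q| / 8`.
  set τ : ℝ := 16 * 5 ^ n with hτdef
  have hτ : 0 < τ := by positivity
  set v := logMaximal G τ with hv
  have hvm : Measurable v := measurable_logMaximal G τ
  have hv0 : ∀ x, 0 ≤ v x := logMaximal_nonneg G τ
  have hVol : ∀ k : ℕ, volume {x | (k : ℝ) < v x} ≤ volume Q.toSet / 16 * 2⁻¹ ^ k := by
    intro k
    refine (volume_lt_logMaximal_le hn G hτ k).trans (mul_le_mul_left ?_ _)
    rw [hτdef, mul_comm (16 : ℝ), ENNReal.ofReal_mul (by positivity),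
      ENNReal.ofReal_pow (by norm_num), ENNReal.ofReal_ofNat, ENNReal.ofReal_ofNat,
      ENNReal.mul_div_mul_left _ _ (by simp) (by simp)]
    exact ENNReal.div_le_div_right hG _
  set E : Set (Fin n → ℝ) := {x | 0 < v x} ∪ (Q.child fun _ => false).toSet with hE
  have hEm : MeasurableSet E :=
    (measurableSet_lt measurable_const hvm).union (Cube.measurableSet_toSet _)
  set h : (Fin n → ℝ) → ℝ := fun x => v x + E.indicator 1 x with hh
  have hhm : Measurable h := hvm.add (measurable_one.indicator hEm)
  have hosc : ∀ P : Cube n, ∃ c : ℝ, ∫⁻ x in P.toSet, ‖h x - c‖ₑ ≤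
      (2 * 15 ^ n + 1) * volume P.toSet := by
    intro P
    obtain ⟨c, hc⟩ := exists_lintegral_logMaximal_sub_le hn hGtop hτ P
    refine ⟨c, ?_⟩
    calc ∫⁻ x in P.toSet, ‖h x - c‖ₑ ≤ ∫⁻ x in P.toSet, (‖v x - c‖ₑ + 1) := by
          refine lintegral_mono fun x => ?_
          rw [hh, show v x + E.indicator 1 x - c = (v x - c) + E.indicator 1 x by ring]
          refine (enorm_add_le _ _).trans (add_le_add le_rfl ?_)
          by_cases hx : x ∈ E <;> simp [hx]
      _ = (∫⁻ x in P.toSet, ‖v x - c‖ₑ) + volume P.toSet := by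
          rw [lintegral_add_right _ measurable_const, setLIntegral_const, one_mul]
      _ ≤ _ := by
          rw [add_mul, one_mul]
          exact add_le_add hc le_rfl
  have hloc : LocallyIntegrable h := locallyIntegrable_of_forall_cube hhm
    (ENNReal.add_ne_top.2 ⟨ENNReal.mul_ne_top (by simp) (by simp), by simp⟩) hosc
  refine ⟨h, hloc, bmoNorm_le_of_forall_cube hloc hosc, ?_⟩
  have hq := Q.volume_real_toSet_pos
  set q := volume.real Q.toSet with hqdef
  -- The two parts of the average of `h` over `Q`.
  have hvint : ∫⁻ x in Q.toSet, ENNReal.ofReal (v x) ≤ 2 * (volume Q.toSet / 16) :=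
    lintegral_ofReal_le_of_forall_volume_le hvm fun k =>
      (measure_mono fun x hx => hx.2).trans (hVol k)
  have hfin : 2 * (volume Q.toSet / 16) ≠ ∞ :=
    ENNReal.mul_ne_top (by simp) (ENNReal.div_ne_top Q.volume_toSet_ne_top (by simp))
  have hI1 : ∫ x in Q.toSet, v x ≤ q / 8 := by
    rw [integral_eq_lintegral_of_nonneg_ae (Eventually.of_forall hv0) hvm.aestronglyMeasurable]
    refine (ENNReal.toReal_mono hfin hvint).trans (le_of_eq ?_)
    rw [ENNReal.toReal_mul, ENNReal.toReal_div, hqdef, Measure.real]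
    norm_num
    ring
  have hI0 : 0 ≤ ∫ x in Q.toSet, v x := integral_nonneg hv0
  have hEv : volume.real (Q.toSet ∩ E) ≤ q / 16 + 2⁻¹ ^ n * q := by
    have h0 : volume.real {x | 0 < v x} ≤ q / 16 := by
      have h1 := ENNReal.toReal_mono
        (ENNReal.mul_ne_top (ENNReal.div_ne_top Q.volume_toSet_ne_top (by simp)) (by simp))
        (hVol 0)
      simpa [hqdef, Measure.real, ENNReal.toReal_div] using h1
    have hfin0 : volume {x | 0 < v x} ≠ ∞ := by
      refine ne_top_of_le_ne_top ?_ (by simpa using hVol 0)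
      exact ENNReal.div_ne_top Q.volume_toSet_ne_top (by simp)
    calc volume.real (Q.toSet ∩ E) ≤ volume.real E :=
          measureReal_mono inter_subset_right
            (measure_union_lt_top hfin0.lt_top (Cube.volume_toSet_ne_top _).lt_top).ne
      _ ≤ volume.real {x | 0 < v x} + volume.real (Q.child fun _ => false).toSet :=
          measureReal_union_le _ _
      _ ≤ _ := by
          rw [Cube.volume_real_child]
          linarith
  have hEv' : 2⁻¹ ^ n * q ≤ volume.real (Q.toSet ∩ E) := by
    rw [hqdef, ← Q.volume_real_child fun _ => false]
    exact measureReal_mono (subset_inter (Q.child_subset _) subset_union_right)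
      (ne_top_of_le_ne_top Q.volume_toSet_ne_top (measure_mono inter_subset_left))
  have hvI : IntegrableOn v Q.toSet :=
    ⟨hvm.aestronglyMeasurable, by
      refine lt_of_le_of_lt (le_of_eq ?_) (hvint.trans_lt hfin.lt_top)
      exact lintegral_congr fun x => Real.enorm_of_nonneg (hv0 x)⟩
  have hEI : IntegrableOn (E.indicator (1 : (Fin n → ℝ) → ℝ)) Q.toSet :=
    (integrableOn_const Q.volume_toSet_ne_top (C := (1 : ℝ))).indicator hEm
  have havg : q * (⨍ y in Q.toSet, h y) =
      (∫ x in Q.toSet, v x) + volume.real (Q.toSet ∩ E) := by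
    rw [setAverage_eq, smul_eq_mul, mul_inv_cancel_left₀ hq.ne', hh, integral_add hvI hEI,
      integral_indicator_one hEm, measureReal_restrict_apply hEm, inter_comm]
  set M := ⨍ y in Q.toSet, h y with hM
  have hhalf : (2⁻¹ : ℝ) ^ n ≤ 2⁻¹ := pow_le_of_le_one (by norm_num) (by norm_num) hn.ne'
  have hpow0 : (0 : ℝ) < 2⁻¹ ^ n := by positivity
  have hMlow : 2⁻¹ ^ n ≤ M := by nlinarith
  have hMup : M ≤ 11 / 16 := by nlinarith
  filter_upwards [ae_restrict_of_ae (ae_le_maximalFn hGm hGtop),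
    ae_restrict_of_ae (ae_maximalFn_lt_top hn hGtop)] with x hx hxtop
  have hlow : 2⁻¹ ^ n / 2 * (1 + v x) ≤ |h x - M| := by
    by_cases hxE : x ∈ E
    · refine le_trans ?_ (le_abs_self _)
      have : h x = v x + 1 := by simp [hh, hxE]
      rw [this]
      nlinarith [hv0 x]
    · have hvx : v x = 0 := le_antisymm (not_lt.1 fun h' => hxE (Or.inl h')) (hv0 x)
      have : h x = 0 := by simp [hh, hxE, hvx]
      rw [this, hvx, zero_sub, abs_neg]
      exact le_trans (by linarith) (le_abs_self M)
  have hlog : Real.log (1 + (G x).toReal) ≤ Real.log (32 * 5 ^ n) + v x := by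
    set a := (maximalFn G x).toReal with ha
    have hGa : (G x).toReal ≤ a := ENNReal.toReal_mono hxtop.ne hx
    have ha0 : 0 ≤ a := ENNReal.toReal_nonneg
    have h1 : max 1 (a / τ) = Real.exp (v x) := by
      rw [hv, logMaximal, Real.posLog_eq_log_max_one (by positivity),
        Real.exp_log (lt_max_of_lt_left one_pos)]
    have h2 : a ≤ τ * Real.exp (v x) := by
      rw [← h1, ← div_le_iff₀' hτ]
      exact le_max_right _ _
    have h3 : 1 ≤ Real.exp (v x) := Real.one_le_exp (hv0 x)
    have h4 : 1 ≤ τ := by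
      have : (1 : ℝ) ≤ 5 ^ n := one_le_pow₀ (by norm_num)
      linarith
    calc Real.log (1 + (G x).toReal) ≤ Real.log (32 * 5 ^ n * Real.exp (v x)) := by
          refine Real.log_le_log (by positivity) ?_
          have : 32 * 5 ^ n * Real.exp (v x) = 2 * (τ * Real.exp (v x)) := by rw [hτdef]; ring
          nlinarith
      _ = _ := by rw [Real.log_mul (by positivity) (Real.exp_pos _).ne', Real.log_exp]
  have hL : 0 ≤ Real.log (32 * 5 ^ n) := by
    refine Real.log_nonneg ?_
    have : (1 : ℝ) ≤ 5 ^ n := one_le_pow₀ (by norm_num)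
    linarith
  calc Real.log (1 + (G x).toReal) ≤ Real.log (32 * 5 ^ n) + v x := hlog
    _ ≤ (Real.log (32 * 5 ^ n) + 1) * (1 + v x) := by nlinarith [hv0 x]
    _ = (Real.log (32 * 5 ^ n) + 1) * 2 ^ (n + 1) * (2⁻¹ ^ n / 2 * (1 + v x)) := by
        rw [pow_succ, inv_pow]
        field_simp
    _ ≤ _ := by gcongr

lemma ExpLEmbedding.of_bmoEmbedding (hn : 0 < n) {X : FunctionSpaceFamily n} {C : ℝ≥0}
    (hC : C ≠ 0) (h : BMOEmbedding X C) :
    ExpLEmbedding X (Real.toNNReal ((Real.log (32 * 5 ^ n) + 1) * 2 ^ (n + 1)) *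
      (2 * (2 * 15 ^ n + 1)) * C) := by
  have hL : 0 ≤ Real.log (32 * 5 ^ n) := by
    refine Real.log_nonneg ?_
    have : (1 : ℝ) ≤ 5 ^ n := one_le_pow₀ (by norm_num)
    linarith
  set K : ℝ := (Real.log (32 * 5 ^ n) + 1) * 2 ^ (n + 1) with hK
  have hK0 : 0 < K := by positivity
  refine ExpLEmbedding.of_forall
    (mul_ne_zero (mul_ne_zero (Real.toNNReal_pos.2 hK0).ne' (by positivity)) hC)
    fun Q f hf α hα hint => ?_
  set g := hf.mk f with hg
  have hgm : Measurable g := hf.measurable_mk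
  have hfg : f =ᵐ[volume.restrict Q.toSet] g := hf.ae_eq_mk
  set G : (Fin n → ℝ) → ℝ≥0∞ :=
    Q.toSet.indicator fun x => ENNReal.ofReal (Real.exp (|g x| / α) - 1) with hGdef
  have hGm : Measurable G := by
    refine Measurable.indicator ?_ Q.measurableSet_toSet
    exact (((hgm.abs.div_const α).exp).sub_const 1).ennreal_ofReal
  have hGint : ∫⁻ y, G y ≤ volume Q.toSet := by
    rw [hGdef, lintegral_indicator Q.measurableSet_toSet]
    refine le_trans (le_of_eq (lintegral_congr_ae ?_)) hint
    filter_upwards [hfg] with x hx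
    rw [hx]
  obtain ⟨w, hw, hwnorm, hwQ⟩ := exists_bmo_majorant hn Q hGm hGint
  have hwtop : bmoNorm w < ∞ := hwnorm.trans_lt (by
    refine ENNReal.mul_lt_top (by simp) (ENNReal.add_lt_top.2 ⟨?_, by simp⟩)
    exact ENNReal.mul_lt_top (by simp) (by simp))
  have hXw : (X Q).nrm (fun x => w x - ⨍ y in Q.toSet, w y) ≤ C * (2 * (2 * 15 ^ n + 1)) :=
    (le_iSup (fun Q : Cube n => (X Q).nrm fun x => w x - ⨍ y in Q.toSet, w y) Q).trans
      ((h w hw hwtop).trans (mul_le_mul_right hwnorm _))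
  refine ((X Q).nrm_le_of_abs_le hf (c := α * K) (by positivity) ?_).trans
    ((mul_le_mul_right hXw _).trans (le_of_eq ?_))
  · filter_upwards [hfg, hwQ, ae_restrict_mem Q.measurableSet_toSet] with x hx hwx hxQ
    have hexp : 0 ≤ Real.exp (|g x| / α) - 1 :=
      sub_nonneg.2 (Real.one_le_exp (by positivity))
    rw [hGdef, indicator_of_mem hxQ, ENNReal.toReal_ofReal hexp, add_sub_cancel, Real.log_exp,
      div_le_iff₀' hα] at hwx
    rw [hx, mul_assoc]
    exact hwx
  · rw [ENNReal.ofReal_mul hα.le]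
    push_cast
    rw [ENNReal.ofNNReal_toNNReal]
    ring

end Majorant

/-! ### The equivalence -/

section Monotonicity

variable {n : ℕ} {X : FunctionSpaceFamily n} {C D : ℝ≥0}

lemma BMOEmbedding.mono (h : BMOEmbedding X C) (hCD : C ≤ D) : BMOEmbedding X D :=
  fun f hf hfin => (h f hf hfin).trans (mul_le_mul_left (ENNReal.coe_le_coe.2 hCD) _)

lemma SparseBound.mono {η : ℝ} (h : SparseBound η X C) (hCD : C ≤ D) : SparseBound η X D :=
  fun Q F hF hs => (h Q F hF hs).trans (ENNReal.coe_le_coe.2 hCD)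

lemma NestedBound.mono {γ : ℝ} (h : NestedBound γ X C) (hCD : C ≤ D) : NestedBound γ X D :=
  fun Q Ω h1 h2 h3 h4 => (h Q Ω h1 h2 h3 h4).trans (ENNReal.coe_le_coe.2 hCD)

lemma ExpLEmbedding.mono (h : ExpLEmbedding X C) (hCD : C ≤ D) : ExpLEmbedding X D :=
  fun Q f hf hfin => (h Q f hf hfin).trans (mul_le_mul_left (ENNReal.coe_le_coe.2 hCD) _)

end Monotonicity

lemma exists_forall_expLEmbedding (n : ℕ) (hn : 0 < n) (η γ : ℝ) (hη : η ∈ Ioo (0 : ℝ) 1)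
    (hγ : γ ∈ Ioo (0 : ℝ) 1) :
    ∃ c : ℝ≥0, 1 ≤ c ∧ ∀ X : FunctionSpaceFamily n,
      ∀ A ∈ [BMOEmbedding X, SparseBound η X, NestedBound γ X, ExpLEmbedding X],
        ∀ C : ℝ≥0, 0 < C → A C → ExpLEmbedding X (c * C) := by
  set kB : ℝ≥0 := Real.toNNReal ((Real.log (32 * 5 ^ n) + 1) * 2 ^ (n + 1)) *
    (2 * (2 * 15 ^ n + 1))
  set kS : ℝ≥0 := Real.toNNReal (2 * 5 ^ n / (1 - η) + 2 ^ n)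
  set kN : ℝ≥0 := Real.toNNReal (Real.log (2 / γ))
  have hkS : kS ≠ 0 := by
    have : 0 < 1 - η := by linarith [hη.2]
    exact (Real.toNNReal_pos.2 (by positivity)).ne'
  refine ⟨1 + kB + kB * kS + kN, by simp [add_assoc], fun X A hA C hC h => ?_⟩
  have hB : kB ≤ 1 + kB + kB * kS + kN := le_add_right (le_add_right le_add_self)
  have hN : kN ≤ 1 + kB + kB * kS + kN := le_add_self
  simp only [List.mem_cons, List.not_mem_nil, or_false] at hA
  rcases hA with rfl | rfl | rfl | rfl
  · exact (ExpLEmbedding.of_bmoEmbedding hn hC.ne' h).mono (mul_le_mul_left hB C)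
  · refine (ExpLEmbedding.of_bmoEmbedding hn (mul_ne_zero hkS hC.ne')
      (BMOEmbedding.of_sparseBound hn hη h)).mono ?_
    change kB * (kS * C) ≤ _
    rw [← mul_assoc]
    exact mul_le_mul_left (le_add_right le_add_self) C
  · exact (ExpLEmbedding.of_nestedBound hγ hC.ne' h).mono (mul_le_mul_left hN C)
  · exact h.mono (le_mul_of_one_le_left zero_le (by simp [add_assoc]))

lemma exists_forall_of_expLEmbedding (n : ℕ) (hn : 0 < n) (η γ : ℝ) (hη : η ∈ Ioo (0 : ℝ) 1)
    (hγ : γ ∈ Ioo (0 : ℝ) 1) :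
    ∃ c : ℝ≥0, 1 ≤ c ∧ ∀ X : FunctionSpaceFamily n,
      ∀ B ∈ [BMOEmbedding X, SparseBound η X, NestedBound γ X, ExpLEmbedding X],
        ∀ C : ℝ≥0, ExpLEmbedding X C → B (c * C) := by
  set kS : ℝ≥0 := Real.toNNReal (2 * 5 ^ n / (1 - η) + 2 ^ n)
  set kE : ℝ≥0 := Real.toNNReal (Real.log (2 / (1 + (1 - η))))⁻¹
  set kN : ℝ≥0 := Real.toNNReal (Real.log (2 / (1 + γ)))⁻¹
  refine ⟨1 + kE + kS * kE + kN, by simp [add_assoc], fun X B hB C h => ?_⟩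
  have hE : kE ≤ 1 + kE + kS * kE + kN := le_add_right (le_add_right le_add_self)
  have hN : kN ≤ 1 + kE + kS * kE + kN := le_add_self
  have hη' : 1 - η ∈ Ioo (0 : ℝ) 1 := ⟨by linarith [hη.2], by linarith [hη.1]⟩
  have hS : SparseBound η X (kE * C) :=
    SparseBound.of_nestedBound hn hη (NestedBound.of_expLEmbedding hη' h)
  simp only [List.mem_cons, List.not_mem_nil, or_false] at hB
  rcases hB with rfl | rfl | rfl | rfl
  · refine (BMOEmbedding.of_sparseBound hn hη hS).mono ?_
    change kS * (kE * C) ≤ _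
    rw [← mul_assoc]
    exact mul_le_mul_left (le_add_right le_add_self) C
  · exact hS.mono (mul_le_mul_left hE C)
  · exact (NestedBound.of_expLEmbedding hγ h).mono (mul_le_mul_left hN C)
  · exact h.mono (le_mul_of_one_le_left zero_le (by simp [add_assoc]))

theorem mainTheorem1 (n : ℕ) (hn : 0 < n) (η γ : ℝ) (hη : η ∈ Set.Ioo (0 : ℝ) 1)
    (hγ : γ ∈ Set.Ioo (0 : ℝ) 1) :
    ∃ c : ℝ≥0, 1 ≤ c ∧ ∀ X : FunctionSpaceFamily n, IsNormalizedFamily X →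
      List.TFAE [
        ∃ C₁ : ℝ≥0, 0 < C₁ ∧ BMOEmbedding X C₁,
        ∃ C₂ : ℝ≥0, 0 < C₂ ∧ SparseBound η X C₂,
        ∃ C₃ : ℝ≥0, 0 < C₃ ∧ NestedBound γ X C₃,
        ∃ C₄ : ℝ≥0, 0 < C₄ ∧ ExpLEmbedding X C₄] ∧
      -- comparability of the constants: each estimate with constant `C` gives every other
      -- one with constant `c * C`
      ∀ A ∈ [BMOEmbedding X, SparseBound η X, NestedBound γ X, ExpLEmbedding X],
        ∀ B ∈ [BMOEmbedding X, SparseBound η X, NestedBound γ X, ExpLEmbedding X],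
          ∀ C : ℝ≥0, 0 < C → A C → B (c * C) := by
  obtain ⟨c₁, hc₁, h₁⟩ := exists_forall_expLEmbedding n hn η γ hη hγ
  obtain ⟨c₂, hc₂, h₂⟩ := exists_forall_of_expLEmbedding n hn η γ hη hγ
  have hc : 1 ≤ c₂ * c₁ := one_le_mul hc₂ hc₁
  refine ⟨c₂ * c₁, hc, fun X _ => ?_⟩
  have key : ∀ A ∈ [BMOEmbedding X, SparseBound η X, NestedBound γ X, ExpLEmbedding X],
      ∀ B ∈ [BMOEmbedding X, SparseBound η X, NestedBound γ X, ExpLEmbedding X],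
        ∀ C : ℝ≥0, 0 < C → A C → B (c₂ * c₁ * C) := by
    intro A hA B hB C hC h
    rw [mul_assoc]
    exact h₂ X B hB _ (h₁ X A hA C hC h)
  refine ⟨?_, key⟩
  have imp : ∀ A ∈ [BMOEmbedding X, SparseBound η X, NestedBound γ X, ExpLEmbedding X],
      ∀ B ∈ [BMOEmbedding X, SparseBound η X, NestedBound γ X, ExpLEmbedding X],
        (∃ C : ℝ≥0, 0 < C ∧ A C) → ∃ C : ℝ≥0, 0 < C ∧ B C :=
    fun A hA B hB ⟨C, hC, h⟩ =>
      ⟨_, mul_pos (zero_lt_one.trans_le hc) hC, key A hA B hB C hC h⟩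
  tfae_have 1 → 2 := imp _ (by simp) _ (by simp)
  tfae_have 2 → 3 := imp _ (by simp) _ (by simp)
  tfae_have 3 → 4 := imp _ (by simp) _ (by simp)
  tfae_have 4 → 1 := imp _ (by simp) _ (by simp)
  tfae_finish
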